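/- Notation. For a compact convex set $K\subset\mathbb R^n$ with the origin in its interior let $h_K(y)=\max\{x\cdot y:x\in K\}$ be its support function, $\rho_K(x)=\max\{\lambda:\lambda x\in K\}$ (for $x\ne 0$) its radial function, $K^*=\{y: y\cdot x\le 1\text{ for all }x\in K\}$ its polar body, and $\mathcal E(K)=-\int_{S^{n-1}}\log h_K(v)\,dv$, where $dv$ is spherical Lebesgue measure. For $p\neq0$, two such sets $K,Q$ and real $t$ with $|t|$ small, let $K\hat+_p t\cdot Q=(K^*+_p t\cdot Q^*)^*$, where $K^*+_p t\cdot Q^*=\{x: x\cdot v\le (h_{K^*}(v)^p+t\,h_{Q^*}(v)^p)^{1/p}\text{ for all }v\in S^{n-1}\}$. The $L_p$ Aleksandrov integral curvature $J_p(K,\cdot)$ is the unique Borel measure on $S^{n-1}$ such that $$\left.\frac{d}{dt}\mathcal E(K\hat+_p t\cdot Q)\right|_{t=0}=\frac1p\int_{S^{n-1}}\rho_Q(u)^{-p}\,dJ_p(K,u)$$ for every compact convex set $Q\subset\mathbb R^n$ with the origin in its interior. Theorem. Let $-1<p<0$ and let $\mu$ be a non-zero, finite, even Borel measure on $S^{n-1}$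 that is discrete, i.e. concentrated on a finite set. There exists an origin-symmetric polytope $K\subset\mathbb R^n$ with non-empty interior such that $\mu=J_p(K,\cdot)$ if and only if $\mu$ is not concentrated on any great subsphere, i.e. $\mu(\{u\in S^{n-1}:u\cdot w\neq0\})>0$ for every $w\in\mathbb R^n\setminus\{0\}$. -/

import Mathlib

open MeasureTheory

noncomputable section

namespace LpAleksandrov

/-- Euclidean space `ℝⁿ`. -/
abbrev E (n : ℕ) : Type := EuclideanSpace ℝ (Fin n)

/-- The unit sphere `S^{n-1}` of `ℝⁿ`. -/
abbrev S (n : ℕ) : Type := Metric.sphere (0 : E n) 1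

/-- Convex bodies containing the origin in their interior (the class `𝒦_oⁿ`). -/
structure IsBodyO {n : ℕ} (K : Set (E n)) : Prop where
  convex : Convex ℝ K
  isCompact : IsCompact K
  zero_mem_interior : (0 : E n) ∈ interior K

/-- Origin-symmetric convex bodies: compact convex sets with non-empty interior that satisfy
`K = -K` (the class `𝒦_eⁿ`). -/
structure IsBodyE {n : ℕ} (K : Set (E n)) : Prop where
  convex : Convex ℝ K
  isCompact : IsCompact K
  interior_nonempty : (interior K).Nonempty
  symmetric : ∀ x ∈ K, -x ∈ K

/-- A polytope is the convex hull of finitely many points. -/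
def IsPolytope {n : ℕ} (K : Set (E n)) : Prop :=
  ∃ F : Finset (E n), K = convexHull ℝ (F : Set (E n))

/-- The support function `h_K(y) = max {x · y : x ∈ K}`. -/
def supportFn {n : ℕ} (K : Set (E n)) (y : E n) : ℝ :=
  sSup ((fun x : E n => inner ℝ x y) '' K)

/-- The radial function `ρ_K(x) = max {r : r x ∈ K}`. -/
def radialFn {n : ℕ} (K : Set (E n)) (x : E n) : ℝ :=
  sSup {r : ℝ | r • x ∈ K}

/-- The polar body `K^*`. -/
def polarBody {n : ℕ} (K : Set (E n)) : Set (E n) :=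
  {y | ∀ x ∈ K, inner ℝ y x ≤ 1}

/-- The Wulff shape generated by a function on the sphere. -/
def wulffShape {n : ℕ} (f : S n → ℝ) : Set (E n) :=
  {x | ∀ v : S n, inner ℝ x (v : E n) ≤ f v}

/-- The `L_p` combination `K +_p t·L`, for `p ≠ 0`: the Wulff shape of `(h_K^p + t h_L^p)^{1/p}`. -/
def lpCombination {n : ℕ} (p : ℝ) (K : Set (E n)) (t : ℝ) (L : Set (E n)) : Set (E n) :=
  wulffShape fun v => (supportFn K v ^ p + t * supportFn L v ^ p) ^ (1 / p)

/-- The harmonic `L_p` combination `K +̂_p t·L = (K^* +_p t·L^*)^*`. -/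
def harmonicCombination {n : ℕ} (p : ℝ) (K : Set (E n)) (t : ℝ) (L : Set (E n)) : Set (E n) :=
  polarBody (lpCombination p (polarBody K) t (polarBody L))

/-- The entropy integral `ℰ(K) = -∫_{S^{n-1}} log h_K(v) dv`, where `dv` is spherical Lebesgue
measure (of total mass `n ω_n`). -/
def entropy {n : ℕ} (K : Set (E n)) : ℝ :=
  -∫ v : S n, Real.log (supportFn K v) ∂((volume : Measure (E n)).toSphere)

/-- `ν` is the `L_p` Aleksandrov integral curvature `J_p(K, ·)` of `K`, for `p ≠ 0`: the Borel
measure on the sphere with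
`d/dt ℰ(K +̂_p t·Q) |_{t=0} = (1/p) ∫ ρ_Q(u)^{-p} dν(u)` for every convex body `Q` containing the
origin in its interior. -/
def IsLpIntegralCurvature {n : ℕ} (p : ℝ) (K : Set (E n)) (ν : Measure (S n)) : Prop :=
  ∀ Q : Set (E n), IsBodyO Q →
    HasDerivAt (fun t : ℝ => entropy (harmonicCombination p K t Q))
      (1 / p * ∫ u : S n, radialFn Q u ^ (-p) ∂ν) 0

/-- A measure on the sphere is even if antipodal Borel sets have equal measure. -/
def IsEvenMeasure {n : ℕ} (μ : Measure (S n)) : Prop :=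
  ∀ ω : Set (S n), MeasurableSet ω → μ ((fun u : S n => -u) ⁻¹' ω) = μ ω

/-- A measure on the sphere is discrete if it is concentrated on finitely many points. -/
def IsDiscreteMeasure {n : ℕ} (μ : Measure (S n)) : Prop :=
  ∃ F : Set (S n), F.Finite ∧ μ Fᶜ = 0

/-- The great subsphere `{u ∈ S^{n-1} : u · w = 0}`, for `w ≠ 0`. -/
def greatSubsphere {n : ℕ} (w : E n) : Set (S n) :=
  {u | inner ℝ (u : E n) w = 0}

end LpAleksandrov

end

noncomputable section

namespace LpAleksandrov

open Filter Topology Set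
open scoped Pointwise ENNReal

/-! ### Perturbing a maximum over a compact space -/

section CompactSup

variable {X : Type*} [TopologicalSpace X] [CompactSpace X]

/-! Write `q = -p`, so `0 < q < 1`. With `b_L = ρ_L ^ q`, the support function of `K +̂_p t·Q` in
direction `v` satisfies `h ^ q = max_u (u · v)₊ ^ q (b_K(u) + t b_Q(u))`, a maximum of functions
affine in `t` (`supportFn_polarBody_wulffShape`). For a polytope and almost every `v`, the maximum
at `t = 0` is attained at one direction only, that of the vertex `ξ i` whose `cell` contains `v`.
Differentiating the logarithm under the integral gives the variational formula
`hasDerivAt_entropy_harmonicCombination`: the curvature of a polytope is atomic, with mass `σ(cell ξ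
i) ‖ξ i‖ ^ p` in the direction of `ξ i`, where `σ` is spherical Lebesgue measure.

For existence, let `μ` have atoms `m i` at `e i`. The formula reduces the problem to finding weights
`a i > 0` such that the polytope with vertices `a i ^ (1/q) e i` has cells of measure `m i * a i`.
Such weights come from minimizing `∫ log max_i a i (e i · v)₊ ^ q dv` over even `a ≥ 0` with `∑ m i
* a i = 1`. A minimizer exists because this simplex is compact and the logarithms are dominated by
the integrable `|log |e i · v||`. It is interior by `minimizer_pos`, where `q < 1` enters: raising a
zero weight to `ε` costs `O(ε ^ s)` with `s > 1`, against a gain of order `ε`. The Euler–Lagrange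
equation (`measure_cell_eq_of_minimizer`) is then the required identity up to a factor removed by
scaling.

For necessity, if `μ` were concentrated on `w⊥`, the unit ball and its squeezing along `w` would
have the same integral against `μ`. The variational formula separates them, since some cell of
positive measure belongs to a vertex outside `w⊥` (`exists_measure_cell_pos_of_inner_ne_zero`). -/

theorem le_iSup_of_continuous {f : X → ℝ} (hf : Continuous f) (x : X) : f x ≤ ⨆ y, f y :=
  le_ciSup (isCompact_range hf).bddAbove x

theorem exists_eq_iSup_of_continuous [Nonempty X] {f : X → ℝ} (hf : Continuous f) :
    ∃ x, f x = ⨆ y, f y := by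
  obtain ⟨x, -, hx⟩ := isCompact_univ.exists_isMaxOn univ_nonempty hf.continuousOn
  exact ⟨x, le_antisymm (le_iSup_of_continuous hf x)
    (ciSup_le fun y => hx (mem_univ y))⟩

theorem continuous_iSup_of_compact {Y : Type*} [TopologicalSpace Y] {f : Y → X → ℝ}
    (hf : Continuous ↿f) : Continuous fun y => ⨆ x, f y x := by
  have h := (isCompact_univ (X := X)).continuous_sSup hf
  simpa only [image_univ, sSup_range] using h

theorem exists_abs_le_mul_of_pos [Nonempty X] {b₀ b₁ : X → ℝ} (hb₀ : Continuous b₀)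
    (hb₁ : Continuous b₁) (hpos : ∀ x, 0 < b₀ x) : ∃ C : ℝ, 0 < C ∧ ∀ x, |b₁ x| ≤ C * b₀ x := by
  have hc : Continuous fun x => |b₁ x| / b₀ x := hb₁.abs.div hb₀ fun x => (hpos x).ne'
  refine ⟨(⨆ x, |b₁ x| / b₀ x) + 1, ?_, fun x => ?_⟩
  · obtain ⟨x⟩ := ‹Nonempty X›
    have h1 := le_iSup_of_continuous hc x
    have h2 : 0 ≤ |b₁ x| / b₀ x := div_nonneg (abs_nonneg _) (hpos x).le
    linarith
  · have h1 := le_iSup_of_continuous hc x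
    rw [div_le_iff₀ (hpos x)] at h1
    nlinarith [hpos x]

variable [Nonempty X] {w b₀ b₁ : X → ℝ}

theorem iSup_perturb_bounds (hw : Continuous w) (hb₀ : Continuous b₀) (hb₁ : Continuous b₁)
    (hw0 : ∀ x, 0 ≤ w x) {C : ℝ} (hC : ∀ x, |b₁ x| ≤ C * b₀ x) (hC0 : 0 ≤ C)
    (t : ℝ) :
    (1 - C * |t|) * (⨆ x, w x * b₀ x) ≤ ⨆ x, w x * (b₀ x + t * b₁ x) ∧
      ⨆ x, w x * (b₀ x + t * b₁ x) ≤ (1 + C * |t|) * ⨆ x, w x * b₀ x := by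
  have hc0 : Continuous fun x => w x * b₀ x := hw.mul hb₀
  have hct : Continuous fun x => w x * (b₀ x + t * b₁ x) := by fun_prop
  have key : ∀ x, |t * b₁ x| ≤ C * |t| * b₀ x := fun x => by
    rw [abs_mul]; nlinarith [hC x, abs_nonneg t]
  constructor
  · obtain ⟨x, hx⟩ := exists_eq_iSup_of_continuous hc0
    refine le_trans ?_ (le_iSup_of_continuous hct x)
    rw [← hx]
    nlinarith [hw0 x, (abs_le.1 (key x)).1]
  · obtain ⟨x, hx⟩ := exists_eq_iSup_of_continuous hct
    rw [← hx]
    have h : 0 ≤ 1 + C * |t| := by positivity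
    refine le_trans ?_ (mul_le_mul_of_nonneg_left (le_iSup_of_continuous hc0 x) h)
    nlinarith [hw0 x, (abs_le.1 (key x)).2]

/-- The Lipschitz constant does not involve `w`. When `w` depends on a direction `v`, this is the
domination needed to differentiate under the integral. -/
theorem abs_log_iSup_sub_le (hw : Continuous w) (hb₀ : Continuous b₀) (hb₁ : Continuous b₁)
    (hw0 : ∀ x, 0 ≤ w x) {C : ℝ} (hC : ∀ x, |b₁ x| ≤ C * b₀ x) (hC0 : 0 ≤ C)
    (hk : 0 < ⨆ x, w x * b₀ x) {t : ℝ} (ht : C * |t| ≤ 1 / 2) :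
    |Real.log (⨆ x, w x * (b₀ x + t * b₁ x)) - Real.log (⨆ x, w x * b₀ x)| ≤ 2 * C * |t| := by
  obtain ⟨h1, h2⟩ := iSup_perturb_bounds hw hb₀ hb₁ hw0 hC hC0 t
  set k := ⨆ x, w x * b₀ x
  set kt := ⨆ x, w x * (b₀ x + t * b₁ x)
  have hs : 0 ≤ C * |t| := mul_nonneg hC0 (abs_nonneg t)
  have hkt : 0 < kt := lt_of_lt_of_le (by nlinarith) h1
  rw [← Real.log_div hkt.ne' hk.ne', abs_le]
  have hr : 0 < kt / k := div_pos hkt hk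
  constructor
  · have h3 := Real.one_sub_inv_le_log_of_pos hr
    have h4 : (kt / k)⁻¹ ≤ 1 + 2 * C * |t| := by
      rw [inv_div, div_le_iff₀ hkt]
      nlinarith
    linarith
  · have h3 := Real.log_le_sub_one_of_pos hr
    have h4 : kt / k ≤ 1 + C * |t| := by rwa [div_le_iff₀ hk]
    nlinarith

/-- The logarithm of a maximum of affine functions of `t` is differentiable at `0` if the maximum
at `t = 0` is attained at a single point. -/
theorem hasDerivAt_log_iSup (hw : Continuous w) (hb₀ : Continuous b₀) (hb₁ : Continuous b₁)
    (hw0 : ∀ x, 0 ≤ w x) (hpos : ∀ x, 0 < b₀ x) {x₀ : X} (hx₀ : 0 < w x₀)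
    (huniq : ∀ x, x ≠ x₀ → w x * b₀ x < w x₀ * b₀ x₀) :
    HasDerivAt (fun t : ℝ => Real.log (⨆ x, w x * (b₀ x + t * b₁ x))) (b₁ x₀ / b₀ x₀) 0 := by
  obtain ⟨C, hCpos, hC⟩ := exists_abs_le_mul_of_pos hb₀ hb₁ hpos
  have hc0 : Continuous fun x => w x * b₀ x := hw.mul hb₀
  have hct : ∀ t : ℝ, Continuous fun x => w x * (b₀ x + t * b₁ x) := fun t => by fun_prop
  have hk0 : ⨆ x, w x * b₀ x = w x₀ * b₀ x₀ := by
    refine le_antisymm (ciSup_le fun x => ?_) (le_iSup_of_continuous hc0 x₀)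
    by_cases h : x = x₀
    · rw [h]
    · exact (huniq x h).le
  have hkpos : 0 < w x₀ * b₀ x₀ := mul_pos hx₀ (hpos x₀)
  set D := b₁ x₀ / b₀ x₀ with hD
  have hg : Continuous fun x => b₁ x / b₀ x := hb₁.div hb₀ fun x => (hpos x).ne'
  rw [hasDerivAt_iff_isLittleO_nhds_zero, Asymptotics.isLittleO_iff]
  intro ε hε
  have hlin : ∀ᶠ t : ℝ in 𝓝 0, 0 < 1 + t * D ∧ t * D - ε * |t| ≤ Real.log (1 + t * D) := by
    have h1 : HasDerivAt (fun t : ℝ => Real.log (1 + t * D)) D 0 := by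
      have h := (((hasDerivAt_id (0 : ℝ)).mul_const D).const_add 1).log (by simp)
      simpa using h
    rw [hasDerivAt_iff_isLittleO_nhds_zero, Asymptotics.isLittleO_iff] at h1
    have h2 : ∀ᶠ t : ℝ in 𝓝 0, 0 < 1 + t * D := by
      have : ContinuousAt (fun t : ℝ => 1 + t * D) 0 := by fun_prop
      exact this.eventually (lt_mem_nhds (by simp))
    filter_upwards [h1 hε, h2] with t ht ht2
    simp only [zero_add, zero_mul, add_zero, Real.log_one, sub_zero, smul_eq_mul,
      Real.norm_eq_abs] at ht
    exact ⟨ht2, by linarith [(abs_le.1 ht).1]⟩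
  -- By compactness, `w * b₀` on this closed set stays below its global maximum by a positive gap,
  -- which survives small `t`. Maximizers at time `t` therefore have quotient `b₁ / b₀` within `ε`
  -- of `D`.
  have hfar : ∀ᶠ t : ℝ in 𝓝 0, ∀ x, ε ≤ |b₁ x / b₀ x - D| →
      w x * (b₀ x + t * b₁ x) < (1 - C * |t|) * (w x₀ * b₀ x₀) := by
    let Z : Set X := {x | ε ≤ |b₁ x / b₀ x - D|}
    have hZ : IsClosed Z := isClosed_le continuous_const (hg.sub continuous_const).abs
    rcases Z.eq_empty_or_nonempty with h | h
    · filter_upwards with t x hx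
      exact absurd (show x ∈ Z from hx) (by rw [h]; exact notMem_empty x)
    · obtain ⟨z, hz, hmax⟩ := hZ.isCompact.exists_isMaxOn h hc0.continuousOn
      have hzne : z ≠ x₀ := by
        rintro rfl
        have : ε ≤ |b₁ z / b₀ z - D| := hz
        rw [hD, sub_self, abs_zero] at this
        linarith
      have hlt := huniq z hzne
      have hcont : ∀ᶠ t : ℝ in 𝓝 0,
          0 < (1 - C * |t|) * (w x₀ * b₀ x₀) - (1 + C * |t|) * (w z * b₀ z) := by
        have : ContinuousAt (fun t : ℝ =>
          (1 - C * |t|) * (w x₀ * b₀ x₀) - (1 + C * |t|) * (w z * b₀ z)) 0 := by fun_prop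
        exact this.eventually (lt_mem_nhds (by simpa using hlt))
      filter_upwards [hcont] with t ht x hx
      have h1 : w x * b₀ x ≤ w z * b₀ z := hmax hx
      have h2 : t * b₁ x ≤ C * |t| * b₀ x := by
        have := le_abs_self (t * b₁ x)
        rw [abs_mul] at this
        nlinarith [hC x, abs_nonneg t]
      have h3 : 0 ≤ C * |t| := by positivity
      nlinarith [hw0 x]
  have hsmall : ∀ᶠ t : ℝ in 𝓝 0, C * |t| < 1 := by
    have : ContinuousAt (fun t : ℝ => C * |t|) 0 := by fun_prop
    exact this.eventually (gt_mem_nhds (by simp))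
  filter_upwards [hlin, hfar, hsmall] with t hl hf hs
  simp only [zero_add, zero_mul, add_zero, smul_eq_mul, Real.norm_eq_abs]
  rw [hk0]
  obtain ⟨x, hx⟩ := exists_eq_iSup_of_continuous (hct t)
  obtain ⟨hb1, -⟩ := iSup_perturb_bounds hw hb₀ hb₁ hw0 hC hCpos.le t
  rw [hk0] at hb1
  have hktpos : 0 < ⨆ x, w x * (b₀ x + t * b₁ x) := lt_of_lt_of_le (by nlinarith) hb1
  have hlow : (w x₀ * b₀ x₀) * (1 + t * D) ≤ ⨆ x, w x * (b₀ x + t * b₁ x) := by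
    refine le_trans (le_of_eq ?_) (le_iSup_of_continuous (hct t) x₀)
    rw [hD]; have := (hpos x₀).ne'; field_simp
  have hxg : |b₁ x / b₀ x - D| < ε := by
    by_contra hcon
    have := hf x (not_lt.1 hcon)
    rw [hx] at this
    linarith
  have hup : (⨆ x, w x * (b₀ x + t * b₁ x)) ≤ (w x₀ * b₀ x₀) * (1 + t * (b₁ x / b₀ x)) := by
    rw [← hx]
    have h1 : w x * (b₀ x + t * b₁ x) = (w x * b₀ x) * (1 + t * (b₁ x / b₀ x)) := by
      have := (hpos x).ne'; field_simp
    rw [h1]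
    have h2 : w x * b₀ x ≤ w x₀ * b₀ x₀ := hk0 ▸ le_iSup_of_continuous hc0 x
    have h3 : 0 ≤ 1 + t * (b₁ x / b₀ x) := by
      have h4 : 0 < (w x * b₀ x) * (1 + t * (b₁ x / b₀ x)) := by rw [← h1, hx]; exact hktpos
      exact (pos_of_mul_pos_right h4 (mul_nonneg (hw0 x) (hpos x).le)).le
    exact mul_le_mul_of_nonneg_right h2 h3
  rw [← Real.log_div hktpos.ne' hkpos.ne', abs_le]
  set kt := ⨆ x, w x * (b₀ x + t * b₁ x)
  constructor
  · have h1 : Real.log (1 + t * D) ≤ Real.log (kt / (w x₀ * b₀ x₀)) :=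
      Real.log_le_log hl.1 (by rw [le_div_iff₀ hkpos]; linarith)
    linarith [hl.2]
  · have h1 := Real.log_le_sub_one_of_pos (div_pos hktpos hkpos)
    have h2 : kt / (w x₀ * b₀ x₀) ≤ 1 + t * (b₁ x / b₀ x) := by
      rw [div_le_iff₀ hkpos]; linarith
    have h3 : t * (b₁ x / b₀ x - D) ≤ ε * |t| := by
      refine (le_abs_self _).trans ?_
      rw [abs_mul]
      nlinarith [abs_nonneg t]
    linarith

end CompactSup

/-! ### Spherical measure of slabs and integrability of `|u · v| ^ (-r)` -/

section SphereMeasure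

variable {n : ℕ}

/-- Spherical Lebesgue measure. -/
abbrev sphereMeasure (n : ℕ) : Measure (S n) := (volume : Measure (E n)).toSphere

theorem sphere_norm (v : S n) : ‖(v : E n)‖ = 1 := by simp

theorem sphereMeasure_hyperplane {w : E n} (hw : w ≠ 0) :
    sphereMeasure n {v | inner ℝ w (v : E n) = 0} = 0 := by
  have hmeas : MeasurableSet {v : S n | inner ℝ w (v : E n) = 0} :=
    (isClosed_eq (by fun_prop) continuous_const).measurableSet
  rw [sphereMeasure, Measure.toSphere_apply' _ hmeas]
  have hne : LinearMap.ker (innerₗ (E n) w) ≠ ⊤ := by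
    intro h
    have : w ∈ LinearMap.ker (innerₗ (E n) w) := by rw [h]; trivial
    exact hw (by simpa using this)
  have h0 := Measure.addHaar_submodule (volume : Measure (E n)) _ hne
  refine mul_eq_zero_of_right _ (measure_mono_null ?_ h0)
  rintro _ ⟨r, -, _, ⟨v, hv, rfl⟩, rfl⟩
  have hv : inner ℝ w (v : E n) = 0 := hv
  simp [hv]

/-- Compressing the direction `u` by the factor `ε` is a linear map of determinant `ε`, and the
image of the ball of radius 2 covers the slab. -/
theorem volume_slab_le {u : E n} (hu : ‖u‖ = 1) {ε : ℝ} (hε : 0 < ε) (hε1 : ε ≤ 1) :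
    volume {x : E n | ‖x‖ ≤ 1 ∧ |inner ℝ u x| < ε} ≤
      ENNReal.ofReal ε * volume (Metric.closedBall (0 : E n) 2) := by
  let L : E n →ₗ[ℝ] E n := LinearMap.transvection (innerₗ (E n) u) ((ε - 1) • u)
  have huu : inner ℝ u u = (1 : ℝ) := by rw [real_inner_self_eq_norm_sq, hu]; norm_num
  have hdet : LinearMap.det L = ε := by
    rw [LinearMap.transvection.det]
    simp [hu]
  have h := Measure.addHaar_image_linearMap (volume : Measure (E n)) L (Metric.closedBall 0 2)
  rw [hdet, abs_of_pos hε] at h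
  rw [← h]
  refine measure_mono ?_
  rintro x ⟨hx1, hx2⟩
  -- The preimage stretches the `u`-component of `x` by `ε⁻¹`; the added term has norm at most `1 -
  -- ε`.
  refine ⟨x + ((ε⁻¹ - 1) * inner ℝ u x) • u, ?_, ?_⟩
  · rw [mem_closedBall_zero_iff]
    refine (norm_add_le _ _).trans ?_
    rw [norm_smul, hu, mul_one, Real.norm_eq_abs, abs_mul]
    have h1 : 1 ≤ ε⁻¹ := (one_le_inv₀ hε).2 hε1
    rw [abs_of_nonneg (by linarith)]
    have h2 : (ε⁻¹ - 1) * |inner ℝ u x| ≤ (ε⁻¹ - 1) * ε :=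
      mul_le_mul_of_nonneg_left hx2.le (by linarith)
    have h3 : (ε⁻¹ - 1) * ε = 1 - ε := by field_simp
    linarith
  · simp only [L, LinearMap.transvection.apply, innerₗ_apply_apply, inner_add_right,
      inner_smul_right, huu, smul_smul]
    rw [add_assoc, ← add_smul]
    have : (ε⁻¹ - 1) * inner ℝ u x +
        (inner ℝ u x + (ε⁻¹ - 1) * inner ℝ u x * 1) * (ε - 1) = 0 := by
      field_simp; ring
    rw [this, zero_smul, add_zero]

theorem exists_sphereMeasure_slab_le (n : ℕ) : ∃ C : ℝ≥0∞, C ≠ ∞ ∧ ∀ u : S n, ∀ ε : ℝ, 0 < ε →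
    ε ≤ 1 → sphereMeasure n {v | |inner ℝ (u : E n) (v : E n)| < ε} ≤ C * ENNReal.ofReal ε := by
  refine ⟨n * volume (Metric.closedBall (0 : E n) 2),
    ENNReal.mul_ne_top (by simp) measure_closedBall_lt_top.ne, fun u ε hε hε1 => ?_⟩
  have hmeas : MeasurableSet {v : S n | |inner ℝ (u : E n) (v : E n)| < ε} :=
    (isOpen_lt (by fun_prop) continuous_const).measurableSet
  rw [sphereMeasure, Measure.toSphere_apply' _ hmeas, mul_assoc, finrank_euclideanSpace_fin,
    mul_comm (volume _)]
  refine mul_le_mul_right (le_trans (measure_mono ?_) (volume_slab_le (sphere_norm u) hε hε1)) _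
  rintro _ ⟨r, hr, _, ⟨v, hv, rfl⟩, rfl⟩
  have hv : |inner ℝ (u : E n) (v : E n)| < ε := hv
  refine ⟨?_, ?_⟩
  · simp only [norm_smul, sphere_norm, mul_one, Real.norm_eq_abs, abs_of_pos hr.1]
    exact hr.2.le
  · simp only [inner_smul_right, abs_mul, abs_of_pos hr.1]
    nlinarith [hr.1, hr.2, abs_nonneg (inner ℝ (u : E n) (v : E n))]

/-- Layer-cake formula: the superlevel set at `t > 1` lies in a slab of width `t ^ (-1/r)`, whose
measure is integrable in `t` because `1/r > 1`. -/
theorem integrable_abs_inner_rpow_neg (u : S n) {r : ℝ} (hr : 0 < r) (hr1 : r < 1) :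
    Integrable (fun v : S n => |inner ℝ (u : E n) (v : E n)| ^ (-r)) (sphereMeasure n) := by
  have hmeas : Measurable fun v : S n => |inner ℝ (u : E n) (v : E n)| ^ (-r) := by
    have : Measurable fun v : S n => |inner ℝ (u : E n) (v : E n)| :=
      (by fun_prop : Continuous fun v : S n => |inner ℝ (u : E n) (v : E n)|).measurable
    exact this.pow_const _
  have hnn : ∀ v : S n, 0 ≤ |inner ℝ (u : E n) (v : E n)| ^ (-r) := fun v =>
    Real.rpow_nonneg (abs_nonneg _) _
  refine ⟨hmeas.aestronglyMeasurable, ?_⟩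
  rw [hasFiniteIntegral_iff_ofReal (ae_of_all _ hnn),
    lintegral_eq_lintegral_meas_lt _ (ae_of_all _ hnn) hmeas.aemeasurable]
  obtain ⟨C, hC, hslab⟩ := exists_sphereMeasure_slab_le n
  rw [← Ioc_union_Ioi_eq_Ioi (zero_le_one' ℝ)]
  refine (lintegral_union_le _ _ _).trans_lt (ENNReal.add_lt_top.2 ⟨?_, ?_⟩)
  · refine (setLIntegral_mono measurable_const fun t _ => measure_mono (subset_univ _)).trans_lt ?_
    simp only [lintegral_const, Measure.restrict_apply_univ, Real.volume_Ioc]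
    exact ENNReal.mul_lt_top (measure_lt_top _ _) (by simp)
  · have hbound : ∀ t ∈ Ioi (1 : ℝ),
        sphereMeasure n {v : S n | t < |inner ℝ (u : E n) (v : E n)| ^ (-r)} ≤
          C * ENNReal.ofReal (t ^ (-r⁻¹)) := by
      intro t ht
      have ht0 : (0 : ℝ) < t := lt_trans one_pos ht
      refine le_trans (measure_mono fun v hv => ?_) (hslab u _ (Real.rpow_pos_of_pos ht0 _)
        (Real.rpow_le_one_of_one_le_of_nonpos (le_of_lt ht) (by simp [hr.le])))
      have hv : t < |inner ℝ (u : E n) (v : E n)| ^ (-r) := hv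
      change |inner ℝ (u : E n) (v : E n)| < t ^ (-r⁻¹)
      set c := |inner ℝ (u : E n) (v : E n)| with hc
      have hc0 : 0 < c := by
        rcases (abs_nonneg (inner ℝ (u : E n) (v : E n))).eq_or_lt with h | h
        · rw [← hc] at h
          rw [← h, Real.zero_rpow (by linarith)] at hv
          linarith
        · exact h
      have h1 := Real.rpow_lt_rpow_of_neg ht0 hv (show -r⁻¹ < 0 by simp [hr])
      rwa [← Real.rpow_mul hc0.le, neg_mul_neg, mul_inv_cancel₀ hr.ne', Real.rpow_one] at h1
    refine (setLIntegral_mono (by fun_prop) hbound).trans_lt ?_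
    rw [lintegral_const_mul _ (by fun_prop)]
    refine ENNReal.mul_lt_top hC.lt_top ?_
    have hint : IntegrableOn (fun t : ℝ => t ^ (-r⁻¹)) (Ioi 1) :=
      integrableOn_Ioi_rpow_of_lt (by have := (one_lt_inv₀ hr).2 hr1; linarith) one_pos
    exact hint.lintegral_lt_top

theorem abs_log_abs_le {c r : ℝ} (hr : 0 < r) (hc : |c| ≤ 1) :
    |Real.log (|c|)| ≤ |c| ^ (-r) / r := by
  have h := Real.log_le_rpow_div (x := |c|⁻¹) (by positivity) hr
  rw [Real.log_inv, Real.inv_rpow (abs_nonneg c), ← Real.rpow_neg (abs_nonneg c)] at h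
  rwa [abs_of_nonpos (Real.log_nonpos (abs_nonneg c) hc)]

theorem abs_inner_sphere_le_one (u v : S n) : |inner ℝ (u : E n) (v : E n)| ≤ 1 := by
  simpa [sphere_norm] using abs_real_inner_le_norm (u : E n) (v : E n)

theorem integrable_log_abs_inner (u : S n) :
    Integrable (fun v : S n => Real.log |inner ℝ (u : E n) (v : E n)|) (sphereMeasure n) := by
  refine ((integrable_abs_inner_rpow_neg u (r := 1 / 2) (by norm_num) (by norm_num)).div_const
    (1 / 2)).mono' ?_ (ae_of_all _ fun v => ?_)
  · exact (Real.measurable_log.comp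
      (by fun_prop : Continuous fun v : S n =>
        |inner ℝ (u : E n) (v : E n)|).measurable).aestronglyMeasurable
  · exact abs_log_abs_le (r := 1 / 2) (by norm_num) (abs_inner_sphere_le_one u v)

theorem sphereMeasure_neg_preimage {s : Set (S n)} (hs : MeasurableSet s) :
    sphereMeasure n ((fun v => -v) ⁻¹' s) = sphereMeasure n s := by
  have hs' : MeasurableSet ((fun v : S n => -v) ⁻¹' s) :=
    (continuous_neg (G := S n)).measurable hs
  rw [sphereMeasure, Measure.toSphere_apply' _ hs, Measure.toSphere_apply' _ hs']
  congr 1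
  rw [← Measure.measure_neg]
  congr 1
  ext x
  constructor
  · rintro ⟨r, hr, _, ⟨v, hv, rfl⟩, hx⟩
    refine ⟨r, hr, _, ⟨-v, hv, rfl⟩, ?_⟩
    have : r • (v : E n) = -x := hx
    simp [this]
  · rintro ⟨r, hr, _, ⟨v, hv, rfl⟩, rfl⟩
    refine ⟨r, hr, _, ⟨-v, by simpa using hv, rfl⟩, by simp⟩

end SphereMeasure

/-! ### Weights and the cells of a finite family of points -/

section Cells

variable {n : ℕ}

/-- The power `(u · v)₊ ^ q` of the positive part of the inner product. -/
def weight (q : ℝ) (u v : E n) : ℝ := (max (inner ℝ u v) 0) ^ q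

theorem weight_nonneg (q : ℝ) (u v : E n) : 0 ≤ weight q u v :=
  Real.rpow_nonneg (le_max_right _ _) _

theorem continuous_weight {q : ℝ} (hq : 0 < q) :
    Continuous fun x : E n × E n => weight q x.1 x.2 := by
  unfold weight
  exact ((continuous_inner (𝕜 := ℝ)).max continuous_const).rpow_const fun _ => Or.inr hq.le

theorem weight_pos_iff {q : ℝ} (hq : 0 < q) {u v : E n} :
    0 < weight q u v ↔ 0 < inner ℝ u v := by
  constructor
  · intro h
    by_contra hcon
    rw [weight, max_eq_right (not_lt.1 hcon), Real.zero_rpow hq.ne'] at h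
    exact lt_irrefl _ h
  · intro h
    exact Real.rpow_pos_of_pos (lt_max_of_lt_left h) _

theorem weight_smul {q c : ℝ} (hc : 0 ≤ c) (u v : E n) :
    weight q (c • u) v = c ^ q * weight q u v := by
  rw [weight, weight, real_inner_smul_left, ← Real.mul_rpow hc (le_max_right _ _),
    mul_max_of_nonneg _ _ hc, mul_zero]

theorem weight_le_one {q : ℝ} (hq : 0 < q) (u v : S n) : weight q (u : E n) v ≤ 1 :=
  Real.rpow_le_one (le_max_right _ _)
    (max_le ((le_abs_self _).trans (abs_inner_sphere_le_one u v)) zero_le_one) hq.le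

theorem weight_lt_weight {q : ℝ} (hq : 0 < q) {x y v : E n} (hy : 0 < inner ℝ y v)
    (h : inner ℝ x v < inner ℝ y v) : weight q x v < weight q y v :=
  Real.rpow_lt_rpow (le_max_right _ _) ((max_lt h hy).trans_le (le_max_left _ _)) hq

variable {ι : Type*}

/-- The directions in which `ξ i` is the only point of the family `ξ` of largest height. For the
vertices of a polytope this is the spherical image of the vertex, up to its boundary. -/
def cell (ξ : ι → E n) (i : ι) : Set (S n) :=
  {v | ∀ j, j ≠ i → inner ℝ (ξ j) (v : E n) < inner ℝ (ξ i) (v : E n)}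

theorem isOpen_cell [Finite ι] (ξ : ι → E n) (i : ι) : IsOpen (cell ξ i) := by
  have : cell ξ i = ⋂ j, ⋂ _ : j ≠ i,
      {v : S n | inner ℝ (ξ j) (v : E n) < inner ℝ (ξ i) (v : E n)} := by
    ext v; simp [cell]
  rw [this]
  exact isOpen_iInter_of_finite fun j => isOpen_iInter_of_finite fun _ =>
    isOpen_lt (by fun_prop) (by fun_prop)

theorem disjoint_cell {ξ : ι → E n} {i j : ι} (hij : i ≠ j) {v : S n} (hi : v ∈ cell ξ i) :
    v ∉ cell ξ j := fun hj => lt_asymm (hi j hij.symm) (hj i hij)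

/-- Ties for the greatest height occur only in the finitely many null hyperplanes orthogonal to some
`ξ i - ξ j`, nonzero by injectivity. -/
theorem ae_exists_mem_cell [Finite ι] [Nonempty ι] {ξ : ι → E n}
    (hξ : Function.Injective ξ) : ∀ᵐ v ∂(sphereMeasure n), ∃ i, v ∈ cell ξ i := by
  have h : ∀ᵐ v : S n ∂(sphereMeasure n), ∀ i j, i ≠ j → inner ℝ (ξ i - ξ j) (v : E n) ≠ 0 := by
    rw [ae_all_iff]; intro i
    rw [ae_all_iff]; intro j
    by_cases hij : i = j
    · exact ae_of_all _ fun v h => absurd hij h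
    · have := sphereMeasure_hyperplane (sub_ne_zero.2 fun h => hij (hξ h))
      filter_upwards [compl_mem_ae_iff.2 this] with v hv _
      exact hv
  filter_upwards [h] with v hv
  obtain ⟨i, hi⟩ := Finite.exists_max fun i => inner ℝ (ξ i) (v : E n)
  refine ⟨i, fun j hj => lt_of_le_of_ne (hi j) fun heq => hv j i hj ?_⟩
  rw [inner_sub_left, heq, sub_self]

end Cells

/-! ### Differentiation under the integral -/

section Variation

variable {n : ℕ} {X : Type*} [TopologicalSpace X] [CompactSpace X] [Nonempty X]
  {ι : Type*} [Fintype ι]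

/-- Derivative of the logarithmic integral of a family of maxima, when for almost every direction
the maximum at `t = 0` is attained at one of finitely many points. -/
theorem hasDerivAt_integral_log_iSup {q : ℝ} (hq : 0 < q) {ξ : X → E n} {b₀ b₁ : X → ℝ}
    (hξ : Continuous ξ) (hb₀ : Continuous b₀) (hb₁ : Continuous b₁) (hpos : ∀ x, 0 < b₀ x)
    (hex : ∀ v : S n, ∃ x, 0 < inner ℝ (ξ x) (v : E n))
    {A : ι → Set (S n)} (hA : ∀ i, MeasurableSet (A i))
    (hdisj : ∀ i j, i ≠ j → ∀ v ∈ A i, v ∉ A j)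
    (hcover : ∀ᵐ v ∂(sphereMeasure n), ∃ i, v ∈ A i) (x : ι → X)
    (huniq : ∀ i, ∀ v ∈ A i, ∀ y, y ≠ x i →
      weight q (ξ y) v * b₀ y < weight q (ξ (x i)) v * b₀ (x i)) :
    HasDerivAt (fun t : ℝ => ∫ v : S n, Real.log (⨆ y, weight q (ξ y) v * (b₀ y + t * b₁ y))
        ∂(sphereMeasure n))
      (∑ i, (sphereMeasure n).real (A i) * (b₁ (x i) / b₀ (x i))) 0 := by
  classical
  obtain ⟨C, hCpos, hC⟩ := exists_abs_le_mul_of_pos hb₀ hb₁ hpos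
  have hwc : ∀ v : S n, Continuous fun y => weight q (ξ y) v := fun v =>
    (continuous_weight hq).comp (hξ.prodMk continuous_const)
  have hkc : ∀ t : ℝ, Continuous fun v : S n => ⨆ y, weight q (ξ y) v * (b₀ y + t * b₁ y) := by
    intro t
    refine continuous_iSup_of_compact ?_
    have h1 : Continuous fun z : S n × X => weight q (ξ z.2) z.1 :=
      (continuous_weight hq).comp ((hξ.comp continuous_snd).prodMk
        (continuous_subtype_val.comp continuous_fst))
    exact h1.mul (by fun_prop)
  have hk0 : ∀ v : S n, 0 < ⨆ y, weight q (ξ y) v * b₀ y := fun v => by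
    obtain ⟨y, hy⟩ := hex v
    exact lt_of_lt_of_le (mul_pos ((weight_pos_iff hq).2 hy) (hpos y))
      (le_iSup_of_continuous ((hwc v).mul hb₀) y)
  let F' : S n → ℝ := fun v => ∑ i, (A i).indicator (fun _ => b₁ (x i) / b₀ (x i)) v
  have hF'm : Measurable F' :=
    Finset.measurable_sum _ fun i _ => measurable_const.indicator (hA i)
  have hF'int : ∫ v, F' v ∂(sphereMeasure n) =
      ∑ i, (sphereMeasure n).real (A i) * (b₁ (x i) / b₀ (x i)) := by
    rw [integral_finsetSum _ fun i _ => (integrable_const _).indicator (hA i)]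
    refine Finset.sum_congr rfl fun i _ => ?_
    rw [integral_indicator_const _ (hA i), smul_eq_mul]
  -- On this ball `C * |t| ≤ 1 / 2`, the range in which `abs_log_iSup_sub_le` applies.
  have hs : Metric.ball (0 : ℝ) (1 / (2 * C)) ∈ 𝓝 (0 : ℝ) :=
    Metric.ball_mem_nhds _ (by positivity)
  have hmain := hasFDerivAt_integral_of_dominated_loc_of_lip' (𝕜 := ℝ)
    (μ := sphereMeasure n) (x₀ := (0 : ℝ))
    (F := fun t v => Real.log (⨆ y, weight q (ξ y) v * (b₀ y + t * b₁ y)))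
    (F' := fun v => ContinuousLinearMap.toSpanSingleton ℝ (F' v))
    (bound := fun _ => 2 * C) hs
    (fun t _ => (Real.measurable_log.comp (hkc t).measurable).aestronglyMeasurable)
    ?_ ?_ ?_ (integrable_const _) ?_
  · obtain ⟨h1, h2⟩ := hmain
    have h3 := h2.hasDerivAt
    rw [ContinuousLinearMap.integral_apply h1 (1 : ℝ)] at h3
    simp only [ContinuousLinearMap.toSpanSingleton_apply, one_smul] at h3
    rwa [hF'int] at h3
  · have : Continuous fun v : S n =>
        Real.log (⨆ y, weight q (ξ y) v * (b₀ y + 0 * b₁ y)) :=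
      (hkc 0).log fun v => by simpa using (hk0 v).ne'
    exact this.integrable_of_hasCompactSupport (HasCompactSupport.of_compactSpace _)
  · exact ((ContinuousLinearMap.toSpanSingletonCLE (𝕜 := ℝ) (E := ℝ)).continuous.measurable.comp
      hF'm).aestronglyMeasurable
  · refine ae_of_all _ fun v t ht => ?_
    have ht' : C * |t| ≤ 1 / 2 := by
      rw [mem_ball_zero_iff, Real.norm_eq_abs, lt_div_iff₀ (by positivity)] at ht
      linarith
    have := abs_log_iSup_sub_le (hwc v) hb₀ hb₁ (fun y => weight_nonneg _ _ _) hC hCpos.le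
      (hk0 v) ht'
    simpa using this
  · filter_upwards [hcover] with v ⟨i, hi⟩
    have hF'v : F' v = b₁ (x i) / b₀ (x i) := by
      change ∑ j, (A j).indicator (fun _ => b₁ (x j) / b₀ (x j)) v = _
      rw [Finset.sum_eq_single i]
      · rw [indicator_of_mem hi]
      · intro j _ hj
        exact indicator_of_notMem (hdisj i j hj.symm v hi) _
      · simp
    rw [hF'v]
    have hwpos : 0 < weight q (ξ (x i)) v := by
      obtain ⟨y, hy⟩ := hex v
      have hy' := mul_pos ((weight_pos_iff hq).2 hy) (hpos y)
      by_cases h : y = x i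
      · rw [← h]; exact (weight_pos_iff hq).2 hy
      · exact pos_of_mul_pos_left (hy'.trans (huniq i v hi y h)) (hpos _).le
    exact (hasDerivAt_log_iSup (hwc v) hb₀ hb₁ (fun y => weight_nonneg _ _ _) hpos hwpos
      (huniq i v hi)).hasFDerivAt

end Variation

/-! ### Polar bodies, radial functions and Wulff shapes -/

section Bodies

variable {n : ℕ} {K : Set (E n)}

theorem IsBodyE.isBodyO (hK : IsBodyE K) : IsBodyO K := by
  refine ⟨hK.convex, hK.isCompact, ?_⟩
  obtain ⟨x, hx⟩ := hK.interior_nonempty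
  have hneg : -x ∈ interior K := by
    have hKneg : -K = K := by
      ext y
      exact ⟨fun hy => by simpa using hK.symmetric _ hy, fun hy => hK.symmetric _ hy⟩
    have h : interior (-K) = -interior K := ((Homeomorph.neg (E n)).preimage_interior K).symm
    rw [hKneg] at h
    rw [h]
    simpa using hx
  have := hK.convex.interior hx hneg (show (0 : ℝ) ≤ 1 / 2 by norm_num)
    (show (0 : ℝ) ≤ 1 / 2 by norm_num) (by norm_num)
  simpa using this

theorem IsBodyO.exists_closedBall_subset (hK : IsBodyO K) :
    ∃ r : ℝ, 0 < r ∧ Metric.closedBall (0 : E n) r ⊆ K :=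
  Metric.nhds_basis_closedBall.mem_iff.1 (mem_interior_iff_mem_nhds.1 hK.zero_mem_interior)

theorem IsBodyO.zero_mem (hK : IsBodyO K) : (0 : E n) ∈ K := interior_subset hK.zero_mem_interior

theorem zero_mem_polarBody (K : Set (E n)) : (0 : E n) ∈ polarBody K := fun x _ => by simp

theorem IsBodyO.isCompact_polarBody (hK : IsBodyO K) : IsCompact (polarBody K) := by
  refine Metric.isCompact_of_isClosed_isBounded ?_ ?_
  · have : polarBody K = ⋂ x ∈ K, {y | inner ℝ y x ≤ 1} := by ext y; simp [polarBody]
    rw [this]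
    exact isClosed_biInter fun x _ => isClosed_le (by fun_prop) continuous_const
  · obtain ⟨r, hr, hball⟩ := hK.exists_closedBall_subset
    refine (Metric.isBounded_closedBall (x := (0 : E n)) (r := r⁻¹)).subset fun y hy => ?_
    rw [mem_closedBall_zero_iff]
    rcases eq_or_ne y 0 with rfl | hy0
    · simp [hr.le]
    have hyn : 0 < ‖y‖ := norm_pos_iff.2 hy0
    have h := hy ((r / ‖y‖) • y) (hball (by
      rw [mem_closedBall_zero_iff, norm_smul, Real.norm_eq_abs, abs_of_pos (by positivity),
        div_mul_cancel₀ _ hyn.ne']))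
    rw [inner_smul_right, real_inner_self_eq_norm_sq] at h
    have h2 : r / ‖y‖ * ‖y‖ ^ 2 = r * ‖y‖ := by field_simp
    rw [h2] at h
    rw [← one_div, le_div_iff₀ hr]
    linarith

theorem inner_le_supportFn {L : Set (E n)} (hL : IsCompact L) {x : E n} (hx : x ∈ L) (y : E n) :
    inner ℝ x y ≤ supportFn L y :=
  le_csSup (hL.image (by fun_prop)).bddAbove (mem_image_of_mem _ hx)

theorem continuous_supportFn {L : Set (E n)} (hL : IsCompact L) : Continuous (supportFn L) :=
  hL.continuous_sSup (f := fun y x => inner ℝ x y)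
    (by fun_prop : Continuous fun z : E n × E n => inner ℝ z.2 z.1)

theorem isGreatest_radialFn (hK : IsBodyO K) {u : E n} (hu : u ≠ 0) :
    IsGreatest {r : ℝ | r • u ∈ K} (radialFn K u) := by
  have hne : {r : ℝ | r • u ∈ K}.Nonempty := ⟨0, by simpa using hK.zero_mem⟩
  have hcl : IsClosed {r : ℝ | r • u ∈ K} :=
    hK.isCompact.isClosed.preimage (by fun_prop : Continuous fun r : ℝ => r • u)
  have hbdd : BddAbove {r : ℝ | r • u ∈ K} := by
    obtain ⟨R, hR⟩ := hK.isCompact.isBounded.exists_norm_le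
    refine ⟨R / ‖u‖, fun r hr => ?_⟩
    rw [le_div_iff₀ (norm_pos_iff.2 hu)]
    have := hR _ hr
    rw [norm_smul, Real.norm_eq_abs] at this
    exact (mul_le_mul_of_nonneg_right (le_abs_self r) (norm_nonneg u)).trans this
  exact ⟨hcl.csSup_mem hne hbdd, fun r hr => le_csSup hbdd hr⟩

theorem radialFn_pos (hK : IsBodyO K) {u : E n} (hu : u ≠ 0) : 0 < radialFn K u := by
  obtain ⟨r, hr, hball⟩ := hK.exists_closedBall_subset
  have hun : 0 < ‖u‖ := norm_pos_iff.2 hu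
  refine lt_of_lt_of_le (div_pos hr hun) ((isGreatest_radialFn hK hu).2 (hball ?_))
  rw [mem_closedBall_zero_iff, norm_smul, Real.norm_eq_abs, abs_of_pos (by positivity),
    div_mul_cancel₀ _ hun.ne']

theorem radialFn_smul (K : Set (E n)) {c : ℝ} (hc : 0 < c) (u : E n) :
    radialFn K (c • u) = c⁻¹ * radialFn K u := by
  unfold radialFn
  rw [← smul_eq_mul, ← Real.sSup_smul_of_nonneg (inv_nonneg.2 hc.le)]
  congr 1
  ext r
  rw [mem_inv_smul_set_iff₀ hc.ne']
  simp only [mem_ofPred_eq, smul_smul, smul_eq_mul, mul_comm c r]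

theorem supportFn_polarBody (hK : IsBodyO K) {u : E n} (hu : u ≠ 0) :
    supportFn (polarBody K) u = (radialFn K u)⁻¹ := by
  have hρ := radialFn_pos hK hu
  have hmax := isGreatest_radialFn hK hu
  refine le_antisymm ?_ ?_
  · refine csSup_le ⟨_, mem_image_of_mem _ (zero_mem_polarBody K)⟩ ?_
    rintro _ ⟨y, hy, rfl⟩
    have h := hy _ hmax.1
    rw [inner_smul_right] at h
    rw [← one_div, le_div_iff₀ hρ]
    linarith
  · by_contra! hlt
    -- Since `c⁻¹` exceeds the radial function, `c⁻¹ • u` lies outside `K`. A separating functional,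
    -- normalized by its level `s`, lies in the polar body and takes a value above `c` at `u`,
    -- contradicting the choice of `c`.
    obtain ⟨c, hc1, hc2⟩ := exists_between (max_lt hlt (inv_pos.2 hρ))
    have hc0 : 0 < c := (le_max_right _ _).trans_lt hc1
    have hnot : c⁻¹ • u ∉ K := fun h => by
      have := hmax.2 h
      have := inv_strictAnti₀ hc0 hc2
      rw [inv_inv] at this
      linarith
    obtain ⟨f, s, hf1, hf2⟩ :=
      geometric_hahn_banach_closed_point hK.convex hK.isCompact.isClosed hnot
    have hs : 0 < s := by simpa using hf1 0 hK.zero_mem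
    let y : E n := (InnerProductSpace.toDual ℝ (E n)).symm f
    have hy : ∀ x, inner ℝ (s⁻¹ • y) x = s⁻¹ * f x := fun x => by
      rw [real_inner_smul_left, InnerProductSpace.toDual_symm_apply]
    have hmem : s⁻¹ • y ∈ polarBody K := fun x hx => by
      rw [hy, inv_mul_le_iff₀ hs]
      linarith [hf1 x hx]
    have h1 := inner_le_supportFn hK.isCompact_polarBody hmem u
    rw [hy] at h1
    rw [map_smul, smul_eq_mul, lt_inv_mul_iff₀ hc0] at hf2
    have h2 : c < s⁻¹ * f u := by rw [lt_inv_mul_iff₀ hs]; linarith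
    have h3 := le_max_left (supportFn (polarBody K) u) 0
    linarith

/-- The points `u / f(u)`, with `f = b ^ (1/p)`, lie in the polar of the Wulff shape of `f`, and one
of them attains the support value `M = max (u · v)₊ / f(u)`. Nothing exceeds it, because `M⁻¹ v`
lies in the Wulff shape. Taking the power `-p` makes the expression linear in `b`. -/
theorem supportFn_polarBody_wulffShape {p : ℝ} (hp : p < 0) {b : S n → ℝ} (hb : Continuous b)
    (hpos : ∀ u, 0 < b u) (v : S n) :
    supportFn (polarBody (wulffShape fun u => b u ^ (1 / p))) v =
      (⨆ u : S n, weight (-p) (u : E n) v * b u) ^ (1 / (-p)) := by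
  have hq : 0 < -p := by linarith
  have : Nonempty (S n) := ⟨v⟩
  have hc : Continuous fun u : S n => weight (-p) (u : E n) v * b u :=
    ((continuous_weight hq).comp (continuous_subtype_val.prodMk continuous_const)).mul hb
  have hkpos : 0 < ⨆ u : S n, weight (-p) (u : E n) v * b u :=
    lt_of_lt_of_le (mul_pos ((weight_pos_iff hq).2 (by simp)) (hpos v))
      (le_iSup_of_continuous hc v)
  have hval : ∀ u : S n, 0 < inner ℝ (u : E n) (v : E n) →
      (weight (-p) (u : E n) v * b u) ^ (1 / (-p)) =
        inner ℝ (u : E n) (v : E n) * (b u ^ (1 / p))⁻¹ := fun u hu => by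
    rw [weight, max_eq_left hu.le, Real.mul_rpow (by positivity) (hpos u).le,
      ← Real.rpow_mul hu.le, mul_one_div_cancel hq.ne', Real.rpow_one,
      ← Real.rpow_neg (hpos u).le]
    congr 2
    rw [one_div_neg_eq_neg_one_div]
  set M := (⨆ u : S n, weight (-p) (u : E n) v * b u) ^ (1 / (-p)) with hM
  have hMpos : 0 < M := Real.rpow_pos_of_pos hkpos _
  refine IsGreatest.csSup_eq ⟨?_, ?_⟩
  · obtain ⟨u, hu⟩ := exists_eq_iSup_of_continuous hc
    have hupos : 0 < inner ℝ (u : E n) (v : E n) := by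
      rw [← weight_pos_iff hq]
      exact pos_of_mul_pos_left (hu ▸ hkpos) (hpos u).le
    have hf : 0 < b u ^ (1 / p) := Real.rpow_pos_of_pos (hpos u) _
    refine ⟨(b u ^ (1 / p))⁻¹ • (u : E n), fun x hx => ?_, ?_⟩
    · rw [real_inner_smul_left, inv_mul_le_iff₀ hf, real_inner_comm, mul_one]
      exact hx u
    · simp only [real_inner_smul_left]
      rw [hM, ← hu, hval u hupos, mul_comm]
  · rintro _ ⟨y, hy, rfl⟩
    have hmem : M⁻¹ • (v : E n) ∈ wulffShape fun u => b u ^ (1 / p) := fun u => by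
      have hf : 0 < b u ^ (1 / p) := Real.rpow_pos_of_pos (hpos u) _
      rw [real_inner_smul_left, inv_mul_le_iff₀ hMpos, real_inner_comm]
      by_cases hu : 0 < inner ℝ (u : E n) (v : E n)
      · have h := Real.rpow_le_rpow (mul_nonneg (weight_nonneg _ _ _) (hpos u).le)
          (le_iSup_of_continuous hc u) (by positivity : 0 ≤ 1 / (-p))
        rw [hval u hu, ← hM, mul_inv_le_iff₀ hf] at h
        exact h
      · exact (not_lt.1 hu).trans (by positivity)
    have h := hy _ hmem
    rw [inner_smul_right, inv_mul_le_iff₀ hMpos, mul_one] at h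
    exact h

end Bodies

/-! ### The variational formula for polytopes -/

section Polytopes

variable {n : ℕ} {ι : Type*}

theorem inner_lt_of_mem_cell {ξ : ι → E n} {i : ι} {v : S n} (hv : v ∈ cell ξ i) {x : E n}
    (hx : x ∈ convexHull ℝ (range ξ)) (hne : x ≠ ξ i) :
    inner ℝ x (v : E n) < inner ℝ (ξ i) (v : E n) := by
  -- An open half-space together with one boundary point is convex, so it contains the hull as soon
  -- as it contains the family.
  let A : Set (E n) := {x | x = ξ i ∨ inner ℝ x (v : E n) < inner ℝ (ξ i) (v : E n)}
  have hA : Convex ℝ A := by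
    rw [convex_iff_forall_pos]
    intro x hx y hy a b ha hb hab
    have hb' : b = 1 - a := by linarith
    subst hb'
    rcases hx with rfl | hx <;> rcases hy with rfl | hy
    · left; rw [← add_smul, hab, one_smul]
    all_goals
      right
      rw [inner_add_left, real_inner_smul_left, real_inner_smul_left]
      nlinarith
  have hsub : range ξ ⊆ A := by
    rintro _ ⟨j, rfl⟩
    by_cases h : j = i
    · exact Or.inl (by rw [h])
    · exact Or.inr (hv j h)
  exact (convexHull_min hsub hA hx).resolve_left hne

variable {ξ : ι → E n} {i : ι} {v : S n}

theorem inner_pos_of_mem_cell (hK : IsBodyO (convexHull ℝ (range ξ))) (hv : v ∈ cell ξ i) :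
    0 < inner ℝ (ξ i) (v : E n) := by
  obtain ⟨r, hr, hball⟩ := hK.exists_closedBall_subset
  have hmem : r • (v : E n) ∈ convexHull ℝ (range ξ) := hball (by
    rw [mem_closedBall_zero_iff, norm_smul, sphere_norm, mul_one, Real.norm_eq_abs,
      abs_of_pos hr])
  have hval : inner ℝ (r • (v : E n)) (v : E n) = r := by
    rw [real_inner_smul_left, real_inner_self_eq_norm_sq, sphere_norm]; ring
  by_cases h : r • (v : E n) = ξ i
  · rw [← h, hval]; exact hr
  · have := inner_lt_of_mem_cell hv hmem h
    rw [hval] at this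
    exact hr.trans this

theorem ne_zero_of_mem_cell (hK : IsBodyO (convexHull ℝ (range ξ))) (hv : v ∈ cell ξ i) :
    ξ i ≠ 0 := fun h => by
  have := inner_pos_of_mem_cell hK hv
  rw [h, inner_zero_left] at this
  exact lt_irrefl _ this

/-- A point of the hull on the ray beyond `ξ i` would be higher than `ξ i` in the direction `v`. -/
theorem radialFn_eq_norm_of_mem_cell (hK : IsBodyO (convexHull ℝ (range ξ)))
    (hv : v ∈ cell ξ i) {d : S n} (hd : ξ i = ‖ξ i‖ • (d : E n)) :
    radialFn (convexHull ℝ (range ξ)) d = ‖ξ i‖ := by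
  have hd0 : (d : E n) ≠ 0 := norm_ne_zero_iff.1 (by rw [sphere_norm]; exact one_ne_zero)
  have hmax := isGreatest_radialFn hK hd0
  have hpos := inner_pos_of_mem_cell hK hv
  refine le_antisymm ?_ (hmax.2 ?_)
  · by_contra! hlt
    have hne : radialFn (convexHull ℝ (range ξ)) d • (d : E n) ≠ ξ i := fun h => by
      rw [hd] at h
      rw [smul_left_injective ℝ hd0 h] at hlt
      exact lt_irrefl _ hlt
    have h := inner_lt_of_mem_cell hv hmax.1 hne
    rw [hd, real_inner_smul_left] at hpos
    rw [hd, real_inner_smul_left, real_inner_smul_left] at h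
    have := pos_of_mul_pos_right hpos (norm_nonneg _)
    nlinarith
  · rw [mem_ofPred_eq, ← hd]
    exact subset_convexHull ℝ _ (mem_range_self i)

/-- The family may contain points that are not vertices: their cells are empty and contribute
nothing. On a nonempty cell, `b Q / b K` in the direction of `ξ i` equals `(ρ_Q / ‖ξ i‖) ^ (-p)`,
which homogeneity turns into `ρ_Q(ξ i) ^ (-p)`. -/
theorem hasDerivAt_entropy_harmonicCombination [Fintype ι] [Nonempty ι] [Nonempty (S n)] {p : ℝ}
    (hp : p < 0) (hξ : Function.Injective ξ) (hK : IsBodyO (convexHull ℝ (range ξ)))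
    {Q : Set (E n)} (hQ : IsBodyO Q) :
    HasDerivAt (fun t : ℝ => entropy (harmonicCombination p (convexHull ℝ (range ξ)) t Q))
      (1 / p * ∑ i, (sphereMeasure n).real (cell ξ i) * radialFn Q (ξ i) ^ (-p)) 0 := by
  have hq : 0 < -p := by linarith
  have hs0 : ∀ u : S n, (u : E n) ≠ 0 := fun u =>
    norm_ne_zero_iff.1 (by rw [sphere_norm]; exact one_ne_zero)
  set K := convexHull ℝ (range ξ) with hKdef
  let b : Set (E n) → S n → ℝ := fun L u => supportFn (polarBody L) u ^ p
  have hb : ∀ L, IsBodyO L → ∀ u, b L u = radialFn L u ^ (-p) := fun L hL u => by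
    simp only [b]
    rw [supportFn_polarBody hL (hs0 u), Real.inv_rpow (radialFn_pos hL (hs0 u)).le,
      ← Real.rpow_neg (radialFn_pos hL (hs0 u)).le]
  have hbpos : ∀ L, IsBodyO L → ∀ u, 0 < b L u := fun L hL u => by
    rw [hb L hL]; exact Real.rpow_pos_of_pos (radialFn_pos hL (hs0 u)) _
  have hbc : ∀ L, IsBodyO L → Continuous (b L) := fun L hL => by
    refine ((continuous_supportFn hL.isCompact_polarBody).comp
      continuous_subtype_val).rpow_const fun u => Or.inl ?_
    simp only [Function.comp_apply, supportFn_polarBody hL (hs0 u)]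
    exact (inv_pos.2 (radialFn_pos hL (hs0 u))).ne'
  obtain ⟨C, hC0, hC⟩ := exists_abs_le_mul_of_pos (hbc K hK) (hbc Q hQ) (hbpos K hK)
  have hd : ∀ i, ∃ d : S n, ξ i ≠ 0 → ξ i = ‖ξ i‖ • (d : E n) := fun i => by
    by_cases h : ξ i = 0
    -- The origin has no direction, but its cell is empty, so any value serves.
    · exact ⟨Classical.arbitrary _, fun h' => absurd h h'⟩
    · refine ⟨⟨‖ξ i‖⁻¹ • ξ i, ?_⟩, fun _ => ?_⟩
      · simp [norm_smul, norm_ne_zero_iff.2 h]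
      · simp [smul_smul, norm_ne_zero_iff.2 h]
  choose d hd using hd
  have hmain := hasDerivAt_integral_log_iSup (n := n) hq (ξ := fun u : S n => (u : E n))
    continuous_subtype_val (hbc K hK) (hbc Q hQ) (hbpos K hK) (fun v => ⟨v, by simp⟩)
    (A := cell ξ) (fun i => (isOpen_cell ξ i).measurableSet)
    (fun i j hij v hv => disjoint_cell hij hv) (ae_exists_mem_cell hξ) d ?_
  · have hev : (fun t : ℝ => entropy (harmonicCombination p K t Q)) =ᶠ[𝓝 0] fun t =>
        1 / p * ∫ v : S n, Real.log (⨆ u : S n, weight (-p) (u : E n) v * (b K u + t * b Q u))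
          ∂(sphereMeasure n) := by
      have hsmall : ∀ᶠ t : ℝ in 𝓝 0, C * |t| < 1 := by
        have : ContinuousAt (fun t : ℝ => C * |t|) 0 := by fun_prop
        exact this.eventually (gt_mem_nhds (by simp))
      filter_upwards [hsmall] with t ht
      have hpos : ∀ u, 0 < b K u + t * b Q u := fun u => by
        have h1 := neg_abs_le (t * b Q u)
        rw [abs_mul] at h1
        nlinarith [hC u, hbpos K hK u, abs_nonneg t]
      have hct : Continuous fun u => b K u + t * b Q u :=
        (hbc K hK).add (continuous_const.mul (hbc Q hQ))
      rw [entropy, ← integral_const_mul, ← integral_neg]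
      refine integral_congr_ae (ae_of_all _ fun v => ?_)
      have h := supportFn_polarBody_wulffShape hp hct hpos v
      simp only [b] at h ⊢
      simp only [harmonicCombination, lpCombination]
      rw [h, Real.log_rpow]
      · ring
      · have hc : Continuous fun u : S n => weight (-p) (u : E n) v * (b K u + t * b Q u) :=
          ((continuous_weight hq).comp (continuous_subtype_val.prodMk continuous_const)).mul hct
        exact lt_of_lt_of_le (mul_pos ((weight_pos_iff hq).2 (by simp)) (hpos v))
          (le_iSup_of_continuous hc v)
    refine HasDerivAt.congr_of_eventuallyEq ?_ hev
    have hsum : ∀ i, (sphereMeasure n).real (cell ξ i) * radialFn Q (ξ i) ^ (-p) =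
        (sphereMeasure n).real (cell ξ i) * (b Q (d i) / b K (d i)) := ?_
    · simp only [hsum]
      exact hmain.const_mul (1 / p)
    intro i
    rcases (cell ξ i).eq_empty_or_nonempty with h | ⟨v, hv⟩
    · rw [h]; simp
    · have hne := ne_zero_of_mem_cell hK hv
      have hdi := hd i hne
      congr 1
      rw [hb K hK, hb Q hQ, radialFn_eq_norm_of_mem_cell hK hv hdi,
        ← Real.div_rpow (radialFn_pos hQ (hs0 _)).le (norm_nonneg _)]
      conv_lhs => rw [hdi, radialFn_smul Q (norm_pos_iff.2 hne)]
      rw [div_eq_inv_mul]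
  · intro i v hv u hu
    have hne := ne_zero_of_mem_cell hK hv
    have hdi := hd i hne
    have hpos := inner_pos_of_mem_cell hK hv
    have hρ := radialFn_pos hK (hs0 u)
    -- Absorbing `ρ_K(u) ^ (-p)` into the weight replaces `u` by the boundary point `ρ_K(u) u`, so
    -- the comparison is one of heights in `K`.
    rw [hb K hK, hb K hK, radialFn_eq_norm_of_mem_cell hK hv hdi, mul_comm, mul_comm (weight _ _ _),
      ← weight_smul hρ.le, ← weight_smul (norm_nonneg _), ← hdi]
    refine weight_lt_weight hq hpos (inner_lt_of_mem_cell hv (isGreatest_radialFn hK (hs0 u)).1 ?_)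
    intro heq
    apply hu
    have h1 := congrArg norm heq
    rw [norm_smul, sphere_norm, mul_one, Real.norm_eq_abs, abs_of_pos hρ] at h1
    rw [h1] at heq
    exact Subtype.ext (smul_right_injective (E n) (norm_ne_zero_iff.2 hne) (heq.trans hdi))

end Polytopes

/-! ### The minimization problem: existence and positivity of minimizers -/

section Minimization

variable {n : ℕ} {ι : Type*}

/-- The maximum over `i` of `a i * (e i · v)₊ ^ q`. -/
def maxWeight (q : ℝ) (e : ι → S n) (a : ι → ℝ) (v : S n) : ℝ :=
  ⨆ i, weight q (e i : E n) v * a i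

/-- The logarithmic integral of `maxWeight` over the sphere. -/
def logEnergy (q : ℝ) (e : ι → S n) (a : ι → ℝ) : ℝ :=
  ∫ v, Real.log (maxWeight q e a v) ∂(sphereMeasure n)

/-- Nonnegative weights that are invariant under `τ`. -/
structure IsAdmissible (τ : ι → ι) (a : ι → ℝ) : Prop where
  nonneg : ∀ i, 0 ≤ a i
  symm : ∀ i, a (τ i) = a i

variable {q : ℝ} {e : ι → S n} {τ : ι → ι} {a : ι → ℝ}

theorem continuous_maxWeight [Fintype ι] [Nonempty ι] (hq : 0 < q) (e : ι → S n) :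
    Continuous fun z : (ι → ℝ) × S n => maxWeight q e z.1 z.2 := by
  simp only [maxWeight, ← Finset.sup'_univ_eq_ciSup]
  refine Continuous.finset_sup'_apply _ fun i _ => ?_
  refine Continuous.mul ?_ (by fun_prop)
  exact (continuous_weight hq).comp (continuous_const.prodMk
    (continuous_subtype_val.comp continuous_snd))

theorem continuous_maxWeight_right [Fintype ι] [Nonempty ι] (hq : 0 < q) (e : ι → S n) (a : ι → ℝ) :
    Continuous fun v => maxWeight q e a v := by
  have h := (continuous_maxWeight hq e).comp (Continuous.prodMk_right a)
  exact h

theorem le_maxWeight [Finite ι] (a : ι → ℝ) (i : ι) (v : S n) :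
    weight q (e i : E n) v * a i ≤ maxWeight q e a v :=
  le_ciSup (f := fun i => weight q (e i : E n) v * a i) (Set.finite_range _).bddAbove i

theorem maxWeight_le [Nonempty ι] (hq : 0 < q) {B : ℝ} (ha : ∀ i, 0 ≤ a i) (hB : ∀ i, a i ≤ B)
    (v : S n) : maxWeight q e a v ≤ B :=
  ciSup_le fun i => (mul_le_of_le_one_left (ha i) (weight_le_one hq _ _)).trans (hB i)

/-- Evenness replaces the positive part by the absolute value: where `e i · v` is negative, the
antipodal index supplies the bound. -/
theorem mul_abs_rpow_le_maxWeight [Finite ι] (hτ : ∀ i, e (τ i) = -e i)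
    (ha : IsAdmissible τ a) (i : ι) (v : S n) : a i * |inner ℝ (e i : E n) (v : E n)| ^ q ≤ maxWeight q e a v := by
  rcases le_total 0 (inner ℝ (e i : E n) (v : E n)) with h | h
  · refine le_trans (le_of_eq ?_) (le_maxWeight a i v)
    rw [weight, max_eq_left h, abs_of_nonneg h, mul_comm]
  · refine le_trans (le_of_eq ?_) (le_maxWeight a (τ i) v)
    have h' : inner ℝ ((-e i : S n) : E n) (v : E n) = -inner ℝ (e i : E n) (v : E n) :=
      inner_neg_left _ _
    rw [weight, hτ, h', max_eq_left (by linarith), abs_of_nonpos h, mul_comm, ha.symm]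

theorem abs_log_maxWeight_le [Fintype ι] [Nonempty ι] (hq : 0 < q)
    (hτ : ∀ i, e (τ i) = -e i) (ha : IsAdmissible τ a)
    {B δ : ℝ} (hB : ∀ i, a i ≤ B) (hδ : 0 < δ) {j : ι} (hj : δ ≤ a j) {v : S n}
    (hv : inner ℝ (e j : E n) (v : E n) ≠ 0) :
    |Real.log (maxWeight q e a v)| ≤
      |Real.log B| + |Real.log δ| + q * |Real.log (|inner ℝ (e j : E n) (v : E n)|)| := by
  have hc : 0 < |inner ℝ (e j : E n) (v : E n)| := abs_pos.2 hv
  set c := |inner ℝ (e j : E n) (v : E n)|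
  have hcq : 0 < c ^ q := Real.rpow_pos_of_pos hc q
  have hlow : δ * c ^ q ≤ maxWeight q e a v :=
    (mul_le_mul_of_nonneg_right hj hcq.le).trans (mul_abs_rpow_le_maxWeight hτ ha j v)
  have hpos : 0 < maxWeight q e a v := (mul_pos hδ hcq).trans_le hlow
  have h1 := Real.log_le_log (mul_pos hδ hcq) hlow
  rw [Real.log_mul hδ.ne' hcq.ne', Real.log_rpow hc] at h1
  have h2 := Real.log_le_log hpos (maxWeight_le hq ha.nonneg hB v)
  have h3 := neg_abs_le (Real.log δ)
  have h4 := neg_abs_le (Real.log c)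
  have h5 := le_abs_self (Real.log B)
  have h6 := abs_nonneg (Real.log B)
  have h7 := abs_nonneg (Real.log δ)
  have h8 := mul_nonneg hq.le (abs_nonneg (Real.log c))
  rw [abs_le]
  constructor
  · nlinarith
  · linarith

theorem ae_inner_ne_zero (u : S n) :
    ∀ᵐ v : S n ∂(sphereMeasure n), inner ℝ (u : E n) (v : E n) ≠ 0 := by
  have hu : (u : E n) ≠ 0 := norm_ne_zero_iff.1 (by rw [sphere_norm]; exact one_ne_zero)
  filter_upwards [compl_mem_ae_iff.2 (sphereMeasure_hyperplane hu)] with v hv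
  exact hv

theorem maxWeight_pos [Finite ι] (hτ : ∀ i, e (τ i) = -e i) (ha : IsAdmissible τ a)
    {j : ι} (hj : 0 < a j) {v : S n} (hv : inner ℝ (e j : E n) (v : E n) ≠ 0) :
    0 < maxWeight q e a v :=
  (mul_pos hj (Real.rpow_pos_of_pos (abs_pos.2 hv) q)).trans_le
    (mul_abs_rpow_le_maxWeight hτ ha j v)

theorem integrable_log_maxWeight [Fintype ι] [Nonempty ι] (hq : 0 < q) (hτ : ∀ i, e (τ i) = -e i)
    (ha : IsAdmissible τ a) {j : ι} (hj : 0 < a j) :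
    Integrable (fun v => Real.log (maxWeight q e a v)) (sphereMeasure n) := by
  have hB : ∀ i, a i ≤ ∑ k, a k := fun i =>
    Finset.single_le_sum (f := a) (fun k _ => ha.nonneg k) (Finset.mem_univ i)
  refine Integrable.mono' (((integrable_const _).add (integrable_const _)).add
    ((integrable_log_abs_inner (e j)).abs.const_mul q))
    (Real.measurable_log.comp (continuous_maxWeight_right hq e a).measurable).aestronglyMeasurable
    ?_ (g := fun v => |Real.log (∑ k, a k)| + |Real.log (a j)| +
      q * |Real.log (|inner ℝ (e j : E n) (v : E n)|)|)
  filter_upwards [ae_inner_ne_zero (e j)] with v hv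
  exact abs_log_maxWeight_le hq hτ ha hB hj le_rfl hv

theorem logEnergy_smul [Fintype ι] [Nonempty ι] (hq : 0 < q) (hτ : ∀ i, e (τ i) = -e i)
    (ha : IsAdmissible τ a) {j : ι} (hj : 0 < a j) {c : ℝ} (hc : 0 < c) :
    logEnergy q e (c • a) = (sphereMeasure n).real univ * Real.log c + logEnergy q e a := by
  have hmul : ∀ v, maxWeight q e (c • a) v = c * maxWeight q e a v := fun v => by
    rw [maxWeight, maxWeight, Real.mul_iSup_of_nonneg hc.le]
    refine iSup_congr fun i => ?_
    simp only [Pi.smul_apply, smul_eq_mul]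
    ring
  have hlog : (fun v => Real.log (maxWeight q e (c • a) v)) =ᵐ[sphereMeasure n]
      fun v => Real.log c + Real.log (maxWeight q e a v) := by
    filter_upwards [ae_inner_ne_zero (e j)] with v hv
    rw [hmul, Real.log_mul hc.ne' (maxWeight_pos hτ ha hj hv).ne']
  rw [logEnergy, integral_congr_ae hlog,
    integral_add (integrable_const _) (integrable_log_maxWeight hq hτ ha hj)]
  simp [logEnergy]

theorem IsAdmissible.exists_pos [Fintype ι] (ha : IsAdmissible τ a) {m : ι → ℝ}
    (h : 0 < ∑ i, m i * a i) : ∃ j, 0 < a j := by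
  by_contra! hcon
  have : ∑ i, m i * a i = 0 := Finset.sum_eq_zero fun i _ => by
    rw [le_antisymm (hcon i) (ha.nonneg i), mul_zero]
  linarith

variable {m : ι → ℝ}

theorem exists_isMinOn_logEnergy [Fintype ι] [Nonempty ι] (hq : 0 < q)
    (hτ : ∀ i, e (τ i) = -e i) (hm : ∀ i, 0 < m i) :
    ∃ a, IsAdmissible τ a ∧ ∑ i, m i * a i = 1 ∧ ∀ a', IsAdmissible τ a' →
      ∑ i, m i * a' i = 1 → logEnergy q e a ≤ logEnergy q e a' := by
  let Δ : Set (ι → ℝ) := {a | IsAdmissible τ a ∧ ∑ i, m i * a i = 1}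
  have hWpos : 0 < ∑ i, m i := Finset.sum_pos (fun i _ => hm i) Finset.univ_nonempty
  have hle : ∀ a ∈ Δ, ∀ i, a i ≤ ∑ k, (m k)⁻¹ := fun a ha i => by
    have h1 : m i * a i ≤ 1 := ha.2 ▸ Finset.single_le_sum (f := fun k => m k * a k)
      (fun k _ => mul_nonneg (hm k).le (ha.1.nonneg k)) (Finset.mem_univ i)
    have h2 : (m i)⁻¹ ≤ ∑ k, (m k)⁻¹ := Finset.single_le_sum (f := fun k => (m k)⁻¹)
      (fun k _ => (inv_pos.2 (hm k)).le) (Finset.mem_univ i)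
    refine le_trans ?_ h2
    rw [← one_div, le_div_iff₀ (hm i)]
    linarith
  -- A lower bound on some weight, uniform over the simplex, keeps the logarithm dominated. Since
  -- `j` varies with `a`, the dominating function below sums over all indices.
  have hge : ∀ a ∈ Δ, ∃ j, (∑ i, m i)⁻¹ ≤ a j := fun a ha => by
    by_contra! hcon
    have : ∑ i, m i * a i < ∑ i, m i * (∑ i, m i)⁻¹ :=
      Finset.sum_lt_sum_of_nonempty Finset.univ_nonempty fun i _ =>
        mul_lt_mul_of_pos_left (hcon i) (hm i)
    rw [ha.2, ← Finset.sum_mul, mul_inv_cancel₀ hWpos.ne'] at this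
    exact lt_irrefl _ this
  have hΔc : IsCompact Δ := by
    refine (isCompact_Icc (a := (0 : ι → ℝ)) (b := fun _ => ∑ k, (m k)⁻¹)).of_isClosed_subset ?_
      fun a ha => ⟨fun i => ha.1.nonneg i, fun i => hle a ha i⟩
    have : Δ = (⋂ i, {a | 0 ≤ a i}) ∩ (⋂ i, {a | a (τ i) = a i}) ∩ {a | ∑ i, m i * a i = 1} := by
      ext a
      simp only [mem_inter_iff, mem_iInter, mem_ofPred_eq, Δ]
      exact ⟨fun h => ⟨⟨h.1.nonneg, h.1.symm⟩, h.2⟩, fun h => ⟨⟨h.1.1, h.1.2⟩, h.2⟩⟩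
    rw [this]
    refine ((isClosed_iInter fun i => ?_).inter (isClosed_iInter fun i => ?_)).inter ?_
    · exact isClosed_le continuous_const (by fun_prop)
    · exact isClosed_eq (by fun_prop) (by fun_prop)
    · exact isClosed_eq (by fun_prop) continuous_const
  have hΔne : Δ.Nonempty := by
    refine ⟨fun _ => (∑ i, m i)⁻¹, ⟨fun _ => (inv_pos.2 hWpos).le, fun _ => rfl⟩, ?_⟩
    rw [← Finset.sum_mul, mul_inv_cancel₀ hWpos.ne']
  have hall : ∀ᵐ v : S n ∂(sphereMeasure n), ∀ i, inner ℝ (e i : E n) (v : E n) ≠ 0 :=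
    ae_all_iff.2 fun i => ae_inner_ne_zero (e i)
  have hcont : ContinuousOn (logEnergy q e) Δ := by
    refine continuousOn_of_dominated
      (F := fun a v => Real.log (maxWeight q e a v)) (bound := fun v => |Real.log (∑ k, (m k)⁻¹)| +
      |Real.log (∑ i, m i)⁻¹| + ∑ i, q * |Real.log (|inner ℝ (e i : E n) (v : E n)|)|)
      (fun a _ => (Real.measurable_log.comp
        (continuous_maxWeight_right hq e a).measurable).aestronglyMeasurable) ?_ ?_ ?_
    · intro a ha
      obtain ⟨j, hj⟩ := hge a ha
      filter_upwards [hall] with v hv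
      refine (abs_log_maxWeight_le hq hτ ha.1 (hle a ha) (inv_pos.2 hWpos) hj (hv j)).trans ?_
      gcongr
      exact Finset.single_le_sum
        (f := fun i => q * |Real.log (|inner ℝ (e i : E n) (v : E n)|)|)
        (fun i _ => mul_nonneg hq.le (abs_nonneg _)) (Finset.mem_univ j)
    · exact ((integrable_const _).add (integrable_const _)).add
        (integrable_finsetSum _ fun i _ => (integrable_log_abs_inner (e i)).abs.const_mul q)
    · filter_upwards [hall] with v hv
      refine ContinuousOn.log ?_ fun a ha => ?_
      · exact ((continuous_maxWeight hq e).comp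
          (continuous_id.prodMk continuous_const)).continuousOn
      · obtain ⟨j, hj⟩ := hge a ha
        exact (maxWeight_pos hτ ha.1 ((inv_pos.2 hWpos).trans_le hj) (hv j)).ne'
  obtain ⟨a, ha, hmin⟩ := hΔc.exists_isMinOn hΔne hcont
  exact ⟨a, ha.1, ha.2, fun a' h1 h2 => hmin (show a' ∈ Δ from ⟨h1, h2⟩)⟩

/-- A minimizer of the logarithmic integral on the simplex minimizes the scale-invariant
functional. -/
theorem exists_minimizer_logEnergy [Fintype ι] [Nonempty ι] (hq : 0 < q) (hτ : ∀ i, e (τ i) = -e i)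
    (hm : ∀ i, 0 < m i) :
    ∃ a, IsAdmissible τ a ∧ ∑ i, m i * a i = 1 ∧ ∀ a', IsAdmissible τ a' →
      0 < ∑ i, m i * a' i → logEnergy q e a ≤
        logEnergy q e a' - (sphereMeasure n).real univ * Real.log (∑ i, m i * a' i) := by
  obtain ⟨a, ha, hsum, hmin⟩ := exists_isMinOn_logEnergy (e := e) hq hτ hm
  refine ⟨a, ha, hsum, fun a' ha' hpos => ?_⟩
  obtain ⟨j, hj⟩ := ha'.exists_pos hpos
  have h := hmin ((∑ i, m i * a' i)⁻¹ • a')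
    ⟨fun i => mul_nonneg (inv_pos.2 hpos).le (ha'.nonneg i), fun i => by
      simp only [Pi.smul_apply, ha'.symm]⟩ ?_
  · rw [logEnergy_smul hq hτ ha' hj (inv_pos.2 hpos), Real.log_inv] at h
    linarith
  · simp only [Pi.smul_apply, smul_eq_mul, mul_left_comm (m _)]
    rw [← Finset.mul_sum, inv_mul_cancel₀ (ne_of_gt hpos)]

/-- The indicator of `i₀` plus the indicator of `τ i₀`. -/
def pairIndicator [DecidableEq ι] (τ : ι → ι) (i₀ i : ι) : ℝ :=
  (if i = i₀ then 1 else 0) + (if i = τ i₀ then 1 else 0)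

theorem pairIndicator_nonneg [DecidableEq ι] (τ : ι → ι) (i₀ i : ι) :
    0 ≤ pairIndicator τ i₀ i := by
  unfold pairIndicator; split_ifs <;> norm_num

theorem pairIndicator_le_two [DecidableEq ι] (τ : ι → ι) (i₀ i : ι) :
    pairIndicator τ i₀ i ≤ 2 := by
  unfold pairIndicator; split_ifs <;> norm_num

theorem pairIndicator_symm [DecidableEq ι] (hττ : Function.Involutive τ) (i₀ i : ι) :
    pairIndicator τ i₀ (τ i) = pairIndicator τ i₀ i := by
  unfold pairIndicator
  have h1 : τ i = i₀ ↔ i = τ i₀ := ⟨fun h => by rw [← h, hττ], fun h => by rw [h, hττ]⟩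
  have h2 : τ i = τ i₀ ↔ i = i₀ := hττ.injective.eq_iff
  simp only [h1, h2, add_comm]

theorem sum_mul_pairIndicator [Fintype ι] [DecidableEq ι] {f : ι → ℝ}
    (hf : ∀ i, f (τ i) = f i) (i₀ : ι) :
    ∑ i, f i * pairIndicator τ i₀ i = 2 * f i₀ := by
  simp [pairIndicator, mul_add, Finset.sum_add_distrib, hf]
  ring

/-- If `a i₀ = 0`, add `ε` at `i₀` and its antipode. The constraint term gains `σ(S) log (1 + 2 ε m
i₀)`, linear in `ε`, while the energy grows by at most `D ε ^ s` with `s > 1`. Dividing by `ε` and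
letting `ε → 0` contradicts minimality. -/
theorem minimizer_pos [Fintype ι] [Nonempty ι] [DecidableEq ι] [Nonempty (S n)] (hq : 0 < q)
    (hq1 : q < 1) (hτ : ∀ i, e (τ i) = -e i) (hττ : Function.Involutive τ) (hm : ∀ i, 0 < m i)
    (hmτ : ∀ i, m (τ i) = m i) (ha : IsAdmissible τ a) (hsum : ∑ i, m i * a i = 1)
    (hmin : ∀ a', IsAdmissible τ a' → 0 < ∑ i, m i * a' i → logEnergy q e a ≤
        logEnergy q e a' - (sphereMeasure n).real univ * Real.log (∑ i, m i * a' i)) (i₀ : ι) :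
    0 < a i₀ := by
  by_contra hcon
  have hi₀ : a i₀ = 0 := le_antisymm (not_lt.1 hcon) (ha.nonneg i₀)
  obtain ⟨j, hj⟩ := ha.exists_pos (m := m) (by rw [hsum]; exact one_pos)
  -- The exponent must exceed 1 to beat the linear gain and satisfy `q * s < 1` for `|e j · v| ^
  -- (-(q * s))` to be integrable. Both are possible because `q < 1`.
  obtain ⟨s, hs1, hs2⟩ : ∃ s : ℝ, 1 < s ∧ q * s < 1 := by
    refine ⟨(1 + q) / (2 * q), ?_, ?_⟩
    · rw [lt_div_iff₀ (by positivity)]; linarith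
    · have : q * ((1 + q) / (2 * q)) = (1 + q) / 2 := by field_simp
      rw [this]; linarith
  have hs0 : 0 < s := one_pos.trans hs1
  have hσ : 0 < (sphereMeasure n).real univ :=
    ENNReal.toReal_pos (isOpen_univ.measure_pos _ univ_nonempty).ne' (measure_ne_top _ _)
  set g := pairIndicator τ i₀
  have hint := integrable_abs_inner_rpow_neg (e j) (mul_pos hq hs0) hs2
  set D := (2 / a j) ^ s / s * ∫ v : S n, |inner ℝ (e j : E n) (v : E n)| ^ (-(q * s))
    ∂(sphereMeasure n) with hD
  have hag : ∀ i, g i ≠ 0 → a i = 0 := fun i hi => by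
    by_cases h1 : i = i₀
    · rw [h1, hi₀]
    · by_cases h2 : i = τ i₀
      · rw [h2, ha.symm, hi₀]
      · exact absurd (by simp [g, pairIndicator, h1, h2]) hi
  have key : ∀ ε : ℝ, 0 < ε →
      (sphereMeasure n).real univ * Real.log (1 + ε * (2 * m i₀)) ≤ D * ε ^ s := by
    intro ε hε
    have ha' : IsAdmissible τ fun i => a i + ε * g i :=
      ⟨fun i => add_nonneg (ha.nonneg i) (mul_nonneg hε.le (pairIndicator_nonneg _ _ _)),
        fun i => by simp only [ha.symm, g, pairIndicator_symm hττ]⟩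
    have hsum' : ∑ i, m i * (a i + ε * g i) = 1 + ε * (2 * m i₀) := by
      simp only [mul_add, Finset.sum_add_distrib, hsum, mul_left_comm (m _) ε]
      rw [← Finset.mul_sum, sum_mul_pairIndicator hmτ]
    have hm0 := hm i₀
    have h1 := hmin _ ha' (by rw [hsum']; positivity)
    rw [hsum'] at h1
    have hj' : 0 < a j + ε * g j :=
      add_pos_of_pos_of_nonneg hj (mul_nonneg hε.le (pairIndicator_nonneg _ _ _))
    have h2 : logEnergy q e (fun i => a i + ε * g i) ≤ logEnergy q e a + D * ε ^ s := by
      have hDε : D * ε ^ s = ∫ v : S n, (2 / a j) ^ s / s * ε ^ s *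
          |inner ℝ (e j : E n) (v : E n)| ^ (-(q * s)) ∂(sphereMeasure n) := by
        rw [integral_const_mul, hD]; ring
      rw [hDε, logEnergy, logEnergy,
        ← integral_add (integrable_log_maxWeight hq hτ ha hj) (hint.const_mul _)]
      refine integral_mono_ae (integrable_log_maxWeight hq hτ ha' hj')
        ((integrable_log_maxWeight hq hτ ha hj).add (hint.const_mul _)) ?_
      filter_upwards [ae_inner_ne_zero (e j)] with v hv
      have hk := maxWeight_pos (q := q) hτ ha hj hv
      have hk' := maxWeight_pos (q := q) hτ ha' hj' hv
      have hc : 0 < |inner ℝ (e j : E n) (v : E n)| := abs_pos.2 hv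
      have hkl := mul_abs_rpow_le_maxWeight (q := q) hτ ha j v
      set c := |inner ℝ (e j : E n) (v : E n)|
      have hcq : 0 < c ^ q := Real.rpow_pos_of_pos hc q
      -- Only indices with `a i = 0` are perturbed, and their terms are at most `2 * ε`. The
      -- logarithm can thus increase only where the old maximum is below `2 * ε`, and there `log x ≤
      -- x ^ s / s` bounds the increase.
      have hupper : maxWeight q e (fun i => a i + ε * g i) v ≤
          max (maxWeight q e a v) (2 * ε) := by
        refine ciSup_le fun i => ?_
        beta_reduce
        by_cases hgi : g i = 0
        · rw [hgi, mul_zero, add_zero]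
          exact (le_maxWeight a i v).trans (le_max_left _ _)
        · rw [hag i hgi, zero_add]
          refine le_trans ?_ (le_max_right _ _)
          have hg2 : g i ≤ 2 := pairIndicator_le_two _ _ _
          refine (mul_le_of_le_one_left (mul_nonneg hε.le (pairIndicator_nonneg _ _ _))
            (weight_le_one hq _ _)).trans ?_
          nlinarith
      have hterm : 0 ≤ (2 / a j) ^ s / s * ε ^ s * c ^ (-(q * s)) := by positivity
      have hlog := Real.log_le_log hk' hupper
      rcases le_total (maxWeight q e a v) (2 * ε) with hcase | hcase
      · rw [max_eq_right hcase] at hlog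
        have h3 : Real.log (2 * ε) - Real.log (maxWeight q e a v) ≤
            Real.log (2 * ε / (a j * c ^ q)) := by
          rw [Real.log_div (by positivity) (by positivity)]
          have := Real.log_le_log (by positivity) hkl
          linarith
        have h4 := Real.log_le_rpow_div (x := 2 * ε / (a j * c ^ q)) (by positivity) hs0
        have h5 : (2 * ε / (a j * c ^ q)) ^ s / s =
            (2 / a j) ^ s / s * ε ^ s * c ^ (-(q * s)) := by
          have : 2 * ε / (a j * c ^ q) = 2 / a j * ε * c ^ (-q) := by
            rw [Real.rpow_neg hc.le]; field_simp
          rw [this, Real.mul_rpow (by positivity) (by positivity),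
            Real.mul_rpow (by positivity) hε.le, ← Real.rpow_mul hc.le, neg_mul]
          ring
        rw [h5] at h4
        change Real.log _ ≤ Real.log _ + _
        linarith
      · rw [max_eq_left hcase] at hlog
        change Real.log _ ≤ Real.log _ + _
        linarith
    linarith
  have hm0 := hm i₀
  have key2 : ∀ ε : ℝ, 0 < ε → ε < 1 →
      (sphereMeasure n).real univ * (2 * m i₀ / (1 + 2 * m i₀)) ≤ D * ε ^ (s - 1) := by
    intro ε hε hε1
    have h1 := Real.one_sub_inv_le_log_of_pos (x := 1 + ε * (2 * m i₀)) (by positivity)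
    have h2 : ε * (2 * m i₀ / (1 + 2 * m i₀)) ≤ 1 - (1 + ε * (2 * m i₀))⁻¹ := by
      have : 1 - (1 + ε * (2 * m i₀))⁻¹ = ε * (2 * m i₀ / (1 + ε * (2 * m i₀))) := by
        field_simp; ring
      rw [this]
      refine mul_le_mul_of_nonneg_left (div_le_div_of_nonneg_left (by positivity)
        (by positivity) ?_) hε.le
      nlinarith
    have h3 := key ε hε
    have h4 : ε ^ s = ε ^ (s - 1) * ε := by
      rw [← Real.rpow_add_one hε.ne']; ring_nf
    have h5 := mul_le_mul_of_nonneg_left (h2.trans h1) hσ.le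
    rw [h4] at h3
    refine le_of_mul_le_mul_right ?_ hε
    nlinarith
  have hlim : Tendsto (fun ε : ℝ => D * ε ^ (s - 1)) (𝓝[>] 0) (𝓝 0) := by
    have h : ContinuousAt (fun ε : ℝ => D * ε ^ (s - 1)) 0 :=
      continuousAt_const.mul (Real.continuousAt_rpow_const _ _ (Or.inr (by linarith)))
    have h' := h.tendsto
    rw [Real.zero_rpow (by linarith), mul_zero] at h'
    exact h'.mono_left nhdsWithin_le_nhds
  have hfin : (sphereMeasure n).real univ * (2 * m i₀ / (1 + 2 * m i₀)) ≤ 0 := by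
    refine ge_of_tendsto hlim ?_
    filter_upwards [Ioo_mem_nhdsGT (show (0 : ℝ) < 1 by norm_num)] with ε hε
    exact key2 ε hε.1 hε.2
  have : 0 < (sphereMeasure n).real univ * (2 * m i₀ / (1 + 2 * m i₀)) := by positivity
  linarith

end Minimization

/-! ### The Euler–Lagrange equation and the construction of the polytope -/

section Existence

variable {n : ℕ} {ι : Type*} {q : ℝ} {e : ι → S n} {τ : ι → ι} {a m : ι → ℝ}

theorem cell_smul (ξ : ι → E n) {c : ℝ} (hc : 0 < c) (i : ι) :
    cell (fun j => c • ξ j) i = cell ξ i := by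
  ext v
  simp only [cell, mem_ofPred_eq, real_inner_smul_left, mul_lt_mul_iff_right₀ hc]

theorem cell_neg {ξ : ι → E n} (hττ : Function.Involutive τ) (hξ : ∀ i, ξ (τ i) = -ξ i) (i : ι) :
    cell ξ (τ i) = (fun v => -v) ⁻¹' cell ξ i := by
  ext v
  have hneg : ∀ x : E n, inner ℝ x ((-v : S n) : E n) = -inner ℝ x (v : E n) := fun x =>
    inner_neg_right _ _
  simp only [cell, mem_ofPred_eq, mem_preimage, hneg, hξ, inner_neg_left]
  constructor
  · intro h j hj
    have := h (τ j) (fun h' => hj (hττ.injective h'))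
    rwa [hξ, inner_neg_left] at this
  · intro h j hj
    have := h (τ j) (fun h' => hj (by rw [← h', hττ]))
    rwa [hξ, inner_neg_left, neg_neg] at this

theorem injective_smul_sphere (he : Function.Injective e) {c : ι → ℝ} (hc : ∀ i, 0 < c i) :
    Function.Injective fun i => c i • (e i : E n) := by
  intro i j hij
  have h : c i • (e i : E n) = c j • (e j : E n) := hij
  have h1 := congrArg norm h
  rw [norm_smul, norm_smul, sphere_norm, sphere_norm, mul_one, mul_one, Real.norm_eq_abs,
    Real.norm_eq_abs, abs_of_pos (hc i), abs_of_pos (hc j)] at h1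
  rw [h1] at h
  exact he (Subtype.ext (smul_right_injective (E n) (hc j).ne' h))

/-- The scale-invariant functional is stationary along `a i (1 + t g i)`, with `g` supported on an
antipodal pair. The factor `a i` in the perturbation makes the quotient `b₁ / b₀` equal to `g`, so
the derivative of the energy is the total measure of the two cells, which are equal by symmetry. -/
theorem measure_cell_eq_of_minimizer [Fintype ι] [Nonempty ι] [DecidableEq ι] (hq : 0 < q)
    (he : Function.Injective e) (hτ : ∀ i, e (τ i) = -e i) (hττ : Function.Involutive τ)
    (hspan : ∀ v : S n, ∃ i, inner ℝ (e i : E n) (v : E n) ≠ 0)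
    (hmτ : ∀ i, m (τ i) = m i)
    (ha : IsAdmissible τ a) (hapos : ∀ i, 0 < a i) (hsum : ∑ i, m i * a i = 1)
    (hmin : ∀ a', IsAdmissible τ a' → 0 < ∑ i, m i * a' i → logEnergy q e a ≤
        logEnergy q e a' - (sphereMeasure n).real univ * Real.log (∑ i, m i * a' i)) (i₀ : ι) :
    (sphereMeasure n).real (cell (fun i => a i ^ (1 / q) • (e i : E n)) i₀) =
      (sphereMeasure n).real univ * (m i₀ * a i₀) := by
  set ξ : ι → E n := fun i => a i ^ (1 / q) • (e i : E n) with hξdef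
  have hcpos : ∀ i, 0 < a i ^ (1 / q) := fun i => Real.rpow_pos_of_pos (hapos i) _
  have hξinj : Function.Injective ξ := injective_smul_sphere he hcpos
  have hneg : ∀ i, ((e (τ i) : S n) : E n) = -(e i : E n) := fun i => by rw [hτ]; rfl
  have hξτ : ∀ i, ξ (τ i) = -ξ i := fun i => by
    simp only [hξdef, ha.symm, hneg, smul_neg]
  have hweight : ∀ i (v : S n), weight q (e i : E n) v * a i = weight q (ξ i) v := fun i v => by
    rw [hξdef, weight_smul (hcpos i).le, ← Real.rpow_mul (hapos i).le,
      one_div_mul_cancel hq.ne', Real.rpow_one, mul_comm]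
  have hex : ∀ v : S n, ∃ i, 0 < inner ℝ (e i : E n) (v : E n) := fun v => by
    obtain ⟨i, hi⟩ := hspan v
    rcases lt_or_gt_of_ne hi with h | h
    · exact ⟨τ i, by rw [hneg, inner_neg_left]; linarith⟩
    · exact ⟨i, h⟩
  set g := pairIndicator τ i₀ with hg
  -- The discrete topology makes the finite index set a compact space, so the general variation
  -- lemma applies.
  let _ : TopologicalSpace ι := ⊥
  have : DiscreteTopology ι := ⟨rfl⟩
  have hder := hasDerivAt_integral_log_iSup (n := n) hq (ξ := fun i => (e i : E n)) (b₀ := a)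
    (b₁ := fun i => a i * g i) continuous_of_discreteTopology continuous_of_discreteTopology
    continuous_of_discreteTopology hapos hex (A := cell ξ)
    (fun i => (isOpen_cell ξ i).measurableSet) (fun i j hij v hv => disjoint_cell hij hv)
    (ae_exists_mem_cell hξinj) id (fun i v hv j hj => by
      simp only [id, hweight]
      refine weight_lt_weight hq ?_ (hv j hj)
      obtain ⟨k, hk⟩ := hex v
      have hk' : 0 < inner ℝ (ξ k) (v : E n) := by
        simp only [hξdef, real_inner_smul_left]
        exact mul_pos (hcpos k) hk
      by_cases h : k = i
      · rwa [← h]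
      · exact hk'.trans (hv k h))
  simp only [id] at hder
  have hquot : ∀ i, a i * g i / a i = g i := fun i => by have := (hapos i).ne'; field_simp
  simp only [hquot] at hder
  have hlin : ∀ t : ℝ, ∑ i, m i * (a i + t * (a i * g i)) = 1 + t * (2 * (m i₀ * a i₀)) := by
    intro t
    have h1 : ∀ i, m i * (a i + t * (a i * g i)) = m i * a i + t * (m i * a i * g i) := fun i => by
      ring
    simp only [h1, Finset.sum_add_distrib, hsum, ← Finset.mul_sum]
    rw [hg, sum_mul_pairIndicator (f := fun i => m i * a i) (fun i => by rw [hmτ, ha.symm])]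
  have hder2 : HasDerivAt (fun t : ℝ => logEnergy q e (fun i => a i + t * (a i * g i)) -
      (sphereMeasure n).real univ * Real.log (1 + t * (2 * (m i₀ * a i₀))))
      (∑ i, (sphereMeasure n).real (cell ξ i) * g i -
        (sphereMeasure n).real univ * (2 * (m i₀ * a i₀))) 0 := by
    have h := (((hasDerivAt_id (0 : ℝ)).mul_const (2 * (m i₀ * a i₀))).const_add 1).log (by simp)
    simp only [one_mul, id, zero_mul, add_zero, div_one] at h
    exact HasDerivAt.sub hder (h.const_mul _)
  have hloc : IsLocalMin (fun t : ℝ => logEnergy q e (fun i => a i + t * (a i * g i)) -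
      (sphereMeasure n).real univ * Real.log (1 + t * (2 * (m i₀ * a i₀)))) 0 := by
    have hpos : ∀ᶠ t : ℝ in 𝓝 0, 0 < 1 + t * (2 * (m i₀ * a i₀)) := by
      have : ContinuousAt (fun t : ℝ => 1 + t * (2 * (m i₀ * a i₀))) 0 := by fun_prop
      exact this.eventually (lt_mem_nhds (by simp))
    -- As `g ≤ 2`, this keeps `1 + t * g i`, hence the perturbed weights, nonnegative for both signs
    -- of `t`.
    have hhalf : ∀ᶠ t : ℝ in 𝓝 0, -(1 / 2) < t := lt_mem_nhds (by norm_num)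
    filter_upwards [hpos, hhalf] with t ht ht2
    have h := hmin (fun i => a i + t * (a i * g i)) ⟨fun i => ?_, fun i => ?_⟩ (by rwa [hlin])
    · simpa [hlin] using h
    · have h0 := pairIndicator_nonneg τ i₀ i
      have h2 := pairIndicator_le_two τ i₀ i
      have : 0 ≤ 1 + t * g i := by rw [hg]; nlinarith
      have := mul_nonneg (hapos i).le this
      linarith
    · simp only [ha.symm, hg, pairIndicator_symm hττ]
  have hzero := hloc.hasDerivAt_eq_zero hder2
  rw [hg, sum_mul_pairIndicator (f := fun i => (sphereMeasure n).real (cell ξ i))] at hzero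
  · linarith
  · intro i
    simp only [cell_neg hττ hξτ, Measure.real]
    rw [sphereMeasure_neg_preimage (isOpen_cell ξ i).measurableSet]

/-- Even discrete data on the sphere that are not contained in a great subsphere are realized by
weights whose cells have the prescribed measure. -/
theorem exists_weights [Fintype ι] [Nonempty ι] [Nonempty (S n)] (hq : 0 < q) (hq1 : q < 1)
    (he : Function.Injective e) (hτ : ∀ i, e (τ i) = -e i) (hm : ∀ i, 0 < m i)
    (hmτ : ∀ i, m (τ i) = m i) (hspan : ∀ v : S n, ∃ i, inner ℝ (e i : E n) (v : E n) ≠ 0) :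
    ∃ a : ι → ℝ, (∀ i, 0 < a i) ∧ (∀ i, a (τ i) = a i) ∧ ∀ i,
      (sphereMeasure n).real (cell (fun i => a i ^ (1 / q) • (e i : E n)) i) = m i * a i := by
  classical
  have hττ : Function.Involutive τ := fun i => he (by rw [hτ, hτ, neg_neg])
  obtain ⟨a, ha, hsum, hmin⟩ := exists_minimizer_logEnergy (e := e) hq hτ hm
  have hapos := minimizer_pos hq hq1 hτ hττ hm hmτ ha hsum hmin
  have hcell := measure_cell_eq_of_minimizer hq he hτ hττ hspan hmτ ha hapos hsum hmin
  have hσ : 0 < (sphereMeasure n).real univ :=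
    ENNReal.toReal_pos (isOpen_univ.measure_pos _ univ_nonempty).ne' (measure_ne_top _ _)
  -- Multiplying the weights by the total measure dilates all the points equally. The cells do not
  -- change, and the factor in the Euler–Lagrange equation is absorbed.
  refine ⟨fun i => (sphereMeasure n).real univ * a i, fun i => mul_pos hσ (hapos i),
    fun i => by simp only [ha.symm], fun i => ?_⟩
  have hξ : (fun i => ((sphereMeasure n).real univ * a i) ^ (1 / q) • (e i : E n)) =
      fun i => (sphereMeasure n).real univ ^ (1 / q) • (a i ^ (1 / q) • (e i : E n)) := by
    funext i
    rw [Real.mul_rpow hσ.le (hapos i).le, smul_smul]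
  rw [hξ, cell_smul _ (Real.rpow_pos_of_pos hσ _), hcell]
  ring

theorem isBodyE_convexHull_range [Finite ι] [Nonempty ι] {ξ : ι → E n}
    (hξτ : ∀ i, ξ (τ i) = -ξ i) (hspan : ∀ w : E n, w ≠ 0 → ∃ i, inner ℝ (ξ i) w ≠ 0) :
    IsBodyE (convexHull ℝ (range ξ)) := by
  have hnegmem : ∀ i, -ξ i ∈ range ξ := fun i => ⟨τ i, hξτ i⟩
  refine ⟨convex_convexHull ℝ _, (finite_range ξ).isCompact_convexHull (𝕜 := ℝ), ?_, ?_⟩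
  · rw [interior_convexHull_nonempty_iff_affineSpan_eq_top]
    rw [AffineSubspace.affineSpan_eq_top_iff_vectorSpan_eq_top_of_nonempty ℝ (E n) (E n)
      (range_nonempty ξ), ← Submodule.orthogonal_eq_bot_iff, Submodule.eq_bot_iff]
    intro w hw
    by_contra hne
    obtain ⟨i, hi⟩ := hspan w hne
    -- The vector span contains `ξ i - (-ξ i) = 2 ξ i`, so a vector orthogonal to it is orthogonal
    -- to every `ξ i`.
    have h := hw _ (vsub_mem_vectorSpan ℝ (mem_range_self i) (hnegmem i))
    rw [vsub_eq_sub, sub_neg_eq_add, inner_add_left] at h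
    exact hi (by linarith)
  · intro x hx
    have h : -convexHull ℝ (range ξ) = convexHull ℝ (range ξ) := by
      rw [← convexHull_neg]
      congr 1
      ext y
      constructor
      · rintro ⟨i, hi⟩
        have := hnegmem i
        rwa [hi, neg_neg] at this
      · rintro ⟨i, rfl⟩
        exact hnegmem i
    rw [← h] at hx
    exact hx

end Existence

/-! ### Necessity, tested on ellipsoids -/

section Necessity

variable {n : ℕ}

/-- The ellipsoid `|x|² + s (x · w)² ≤ 1`. -/
def ellipsoid (s : ℝ) (w : E n) : Set (E n) := {x | ‖x‖ ^ 2 + s * inner ℝ x w ^ 2 ≤ 1}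

theorem isBodyO_ellipsoid {s : ℝ} (hs : 0 ≤ s) (w : E n) : IsBodyO (ellipsoid s w) := by
  have hcont : Continuous fun x : E n => ‖x‖ ^ 2 + s * inner ℝ x w ^ 2 := by fun_prop
  refine ⟨?_, ?_, ?_⟩
  · intro x hx y hy a b ha hb hab
    have hx : ‖x‖ ^ 2 + s * inner ℝ x w ^ 2 ≤ 1 := hx
    have hy : ‖y‖ ^ 2 + s * inner ℝ y w ^ 2 ≤ 1 := hy
    change ‖a • x + b • y‖ ^ 2 + s * inner ℝ (a • x + b • y) w ^ 2 ≤ 1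
    have hb' : b = 1 - a := by linarith
    subst hb'
    have h1 : ‖a • x + (1 - a) • y‖ ≤ a * ‖x‖ + (1 - a) * ‖y‖ := by
      refine (norm_add_le _ _).trans (le_of_eq ?_)
      rw [norm_smul, norm_smul, Real.norm_eq_abs, Real.norm_eq_abs, abs_of_nonneg ha,
        abs_of_nonneg hb]
    have h2 : ‖a • x + (1 - a) • y‖ ^ 2 ≤ a * ‖x‖ ^ 2 + (1 - a) * ‖y‖ ^ 2 := by
      refine (pow_le_pow_left₀ (norm_nonneg _) h1 2).trans ?_
      nlinarith [mul_nonneg (mul_nonneg ha hb) (sq_nonneg (‖x‖ - ‖y‖))]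
    have h3 : inner ℝ (a • x + (1 - a) • y) w ^ 2 ≤
        a * inner ℝ x w ^ 2 + (1 - a) * inner ℝ y w ^ 2 := by
      rw [inner_add_left, real_inner_smul_left, real_inner_smul_left]
      nlinarith [mul_nonneg (mul_nonneg ha hb) (sq_nonneg (inner ℝ x w - inner ℝ y w))]
    nlinarith
  · refine Metric.isCompact_of_isClosed_isBounded (isClosed_le hcont continuous_const) ?_
    refine (Metric.isBounded_closedBall (x := (0 : E n)) (r := 1)).subset fun x hx => ?_
    have hx : ‖x‖ ^ 2 + s * inner ℝ x w ^ 2 ≤ 1 := hx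
    rw [mem_closedBall_zero_iff]
    have := mul_nonneg hs (sq_nonneg (inner ℝ x w))
    nlinarith [norm_nonneg x]
  · refine mem_interior.2 ⟨{x | ‖x‖ ^ 2 + s * inner ℝ x w ^ 2 < 1}, fun x hx => ?_,
      isOpen_lt hcont continuous_const, ?_⟩
    · exact le_of_lt (show ‖x‖ ^ 2 + s * inner ℝ x w ^ 2 < 1 from hx)
    · change ‖(0 : E n)‖ ^ 2 + s * inner ℝ (0 : E n) w ^ 2 < 1
      simp

theorem radialFn_ellipsoid_sq {s : ℝ} (hs : 0 ≤ s) (w : E n) {x : E n} (hx : x ≠ 0) :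
    radialFn (ellipsoid s w) x ^ 2 * (‖x‖ ^ 2 + s * inner ℝ x w ^ 2) = 1 := by
  have hK := isBodyO_ellipsoid hs w
  have hmax := isGreatest_radialFn hK hx
  have hρ := radialFn_pos hK hx
  have hN : 0 < ‖x‖ ^ 2 + s * inner ℝ x w ^ 2 := by
    have := norm_pos_iff.2 hx
    positivity
  have hiff : ∀ r : ℝ, r • x ∈ ellipsoid s w ↔ r ^ 2 * (‖x‖ ^ 2 + s * inner ℝ x w ^ 2) ≤ 1 := by
    intro r
    rw [ellipsoid, mem_ofPred_eq, norm_smul, real_inner_smul_left, mul_pow, mul_pow,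
      Real.norm_eq_abs, sq_abs]
    ring_nf
  refine le_antisymm ((hiff _).1 hmax.1) ?_
  have h1 : Real.sqrt (‖x‖ ^ 2 + s * inner ℝ x w ^ 2)⁻¹ ≤ radialFn (ellipsoid s w) x := by
    refine hmax.2 ((hiff _).2 ?_)
    rw [Real.sq_sqrt (inv_pos.2 hN).le, inv_mul_cancel₀ hN.ne']
  have h2 := pow_le_pow_left₀ (Real.sqrt_nonneg _) h1 2
  rw [Real.sq_sqrt (inv_pos.2 hN).le] at h2
  have h3 := mul_le_mul_of_nonneg_right h2 hN.le
  rwa [inv_mul_cancel₀ hN.ne'] at h3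

variable {ι : Type*} {ξ : ι → E n}

/-- Otherwise almost every `v` near `w₀ = w / ‖w‖` lies in the cell of some `ξ i ⟂ w`. The hull
contains a ball of radius `r`, so `r ≤ ξ i · v = ξ i · (v - w₀) ≤ M ‖v - w₀‖`, which fails once `‖v
- w₀‖ < r / M`. -/
theorem exists_measure_cell_pos_of_inner_ne_zero [Fintype ι] [Nonempty ι]
    (hξ : Function.Injective ξ) (hK : IsBodyO (convexHull ℝ (range ξ))) {w : E n} (hw : w ≠ 0) :
    ∃ i, 0 < (sphereMeasure n).real (cell ξ i) ∧ inner ℝ (ξ i) w ≠ 0 := by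
  have hwn : 0 < ‖w‖ := norm_pos_iff.2 hw
  obtain ⟨w₀, hw₀⟩ : ∃ w₀ : S n, (w₀ : E n) = ‖w‖⁻¹ • w :=
    ⟨⟨‖w‖⁻¹ • w, by simp [norm_smul, hwn.ne']⟩, rfl⟩
  obtain ⟨r, hr, hball⟩ := hK.exists_closedBall_subset
  obtain ⟨M, hMpos, hM⟩ : ∃ M : ℝ, 0 < M ∧ ∀ i, ‖ξ i‖ ≤ M := by
    refine ⟨1 + ∑ i, ‖ξ i‖, add_pos_of_pos_of_nonneg one_pos
      (Finset.sum_nonneg fun i _ => norm_nonneg _), fun i => ?_⟩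
    have := Finset.single_le_sum (f := fun i => ‖ξ i‖) (fun k _ => norm_nonneg _)
      (Finset.mem_univ i)
    linarith
  have hU : 0 < sphereMeasure n (Metric.ball w₀ (r / M)) :=
    Metric.isOpen_ball.measure_pos _ ⟨w₀, Metric.mem_ball_self (div_pos hr hMpos)⟩
  by_contra! hcon
  have hae : ∀ᵐ v ∂(sphereMeasure n), v ∉ Metric.ball w₀ (r / M) := by
    have hnull : ∀ᵐ v ∂(sphereMeasure n), ∀ i, inner ℝ (ξ i) w ≠ 0 → v ∉ cell ξ i := by
      rw [ae_all_iff]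
      intro i
      by_cases hi : inner ℝ (ξ i) w = 0
      · exact ae_of_all _ fun v h => absurd hi h
      · have h0 : (sphereMeasure n).real (cell ξ i) = 0 := by
          by_contra hne
          exact hi (hcon i (lt_of_le_of_ne measureReal_nonneg (Ne.symm hne)))
        have h1 : sphereMeasure n (cell ξ i) = 0 :=
          (measureReal_eq_zero_iff (measure_ne_top _ _)).1 h0
        filter_upwards [compl_mem_ae_iff.2 h1] with v hv _
        exact hv
    filter_upwards [hnull, ae_exists_mem_cell hξ] with v hv ⟨i, hi⟩ hvU
    have hiw : inner ℝ (ξ i) w = 0 := by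
      by_contra h
      exact hv i h hi
    have hmem : r • (v : E n) ∈ convexHull ℝ (range ξ) := hball (by
      rw [mem_closedBall_zero_iff, norm_smul, sphere_norm, mul_one, Real.norm_eq_abs,
        abs_of_pos hr])
    have hval : inner ℝ (r • (v : E n)) (v : E n) = r := by
      rw [real_inner_smul_left, real_inner_self_eq_norm_sq, sphere_norm]; ring
    have hle : r ≤ inner ℝ (ξ i) (v : E n) := by
      by_cases h : r • (v : E n) = ξ i
      · rw [← h, hval]
      · rw [← hval]; exact (inner_lt_of_mem_cell hi hmem h).le
    have hdist : ‖(v : E n) - (w₀ : E n)‖ < r / M := by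
      rw [← dist_eq_norm]; exact hvU
    have h1 : inner ℝ (ξ i) (v : E n) = inner ℝ (ξ i) ((v : E n) - (w₀ : E n)) := by
      rw [inner_sub_right]
      rw [hw₀, inner_smul_right, hiw, mul_zero, sub_zero]
    have h2 := real_inner_le_norm (ξ i) ((v : E n) - (w₀ : E n))
    rw [lt_div_iff₀ hMpos] at hdist
    have h4 := mul_le_mul_of_nonneg_right (hM i) (norm_nonneg ((v : E n) - (w₀ : E n)))
    linarith
  exact hU.ne' (measure_eq_zero_iff_ae_notMem.2 hae)

/-- The ellipsoids with `s = 0` and `s = 1` have equal radial functions on `w⊥`, and the second is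
strictly smaller elsewhere. Uniqueness of derivatives equates the `μ`-integrals with the sums over
cells, which differ. -/
theorem measure_compl_greatSubsphere_ne_zero [Fintype ι] [Nonempty ι] [Nonempty (S n)] {p : ℝ}
    (hp : p < 0) (hξ : Function.Injective ξ) (hK : IsBodyO (convexHull ℝ (range ξ)))
    {μ : Measure (S n)} (hμ : IsLpIntegralCurvature p (convexHull ℝ (range ξ)) μ)
    {w : E n} (hw : w ≠ 0) : μ (greatSubsphere w)ᶜ ≠ 0 := by
  intro h0
  have hs0 : ∀ u : S n, (u : E n) ≠ 0 := fun u =>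
    norm_ne_zero_iff.1 (by rw [sphere_norm]; exact one_ne_zero)
  have hQ : ∀ s : ℝ, 0 ≤ s → ∑ i, (sphereMeasure n).real (cell ξ i) *
      radialFn (ellipsoid s w) (ξ i) ^ (-p) = ∫ u : S n, radialFn (ellipsoid s w) u ^ (-p) ∂μ := by
    intro s hs
    have h := (hasDerivAt_entropy_harmonicCombination hp hξ hK (isBodyO_ellipsoid hs w)).unique
      (hμ _ (isBodyO_ellipsoid hs w))
    exact mul_left_cancel₀ (one_div_ne_zero hp.ne) h
  have hint : ∫ u : S n, radialFn (ellipsoid 1 w) u ^ (-p) ∂μ =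
      ∫ u : S n, radialFn (ellipsoid 0 w) u ^ (-p) ∂μ := by
    refine integral_congr_ae ?_
    filter_upwards [compl_mem_ae_iff.2 h0] with u hu
    rw [compl_compl] at hu
    have hu : inner ℝ (u : E n) w = 0 := hu
    have hset : radialFn (ellipsoid 1 w) u = radialFn (ellipsoid 0 w) u := by
      have h1 := radialFn_ellipsoid_sq zero_le_one w (hs0 u)
      have h2 := radialFn_ellipsoid_sq le_rfl w (hs0 u)
      rw [hu, sphere_norm] at h1 h2
      have h3 := radialFn_pos (isBodyO_ellipsoid zero_le_one w) (hs0 u)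
      have h4 := radialFn_pos (isBodyO_ellipsoid le_rfl w) (hs0 u)
      nlinarith
    rw [hset]
  rw [← hQ 1 zero_le_one, ← hQ 0 le_rfl] at hint
  obtain ⟨i, hi, hiw⟩ := exists_measure_cell_pos_of_inner_ne_zero hξ hK hw
  have hlt : ∀ x : E n, x ≠ 0 →
      radialFn (ellipsoid 1 w) x ≤ radialFn (ellipsoid 0 w) x ∧
      (inner ℝ x w ≠ 0 → radialFn (ellipsoid 1 w) x < radialFn (ellipsoid 0 w) x) := by
    intro x hx
    have h1 := radialFn_ellipsoid_sq zero_le_one w hx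
    have h2 := radialFn_ellipsoid_sq le_rfl w hx
    have h3 := radialFn_pos (isBodyO_ellipsoid zero_le_one w) hx
    have h4 := radialFn_pos (isBodyO_ellipsoid le_rfl w) hx
    have hN : 0 < ‖x‖ ^ 2 := by have := norm_pos_iff.2 hx; positivity
    have h5 : (radialFn (ellipsoid 0 w) x ^ 2 - radialFn (ellipsoid 1 w) x ^ 2) * ‖x‖ ^ 2 =
        radialFn (ellipsoid 1 w) x ^ 2 * inner ℝ x w ^ 2 := by linarith
    constructor
    · have h6 : 0 ≤ (radialFn (ellipsoid 0 w) x ^ 2 -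
          radialFn (ellipsoid 1 w) x ^ 2) * ‖x‖ ^ 2 := by
        rw [h5]; positivity
      have h7 := nonneg_of_mul_nonneg_left h6 hN
      exact (pow_le_pow_iff_left₀ h3.le h4.le two_ne_zero).1 (by linarith)
    · intro hxw
      have h6 : 0 < (radialFn (ellipsoid 0 w) x ^ 2 -
          radialFn (ellipsoid 1 w) x ^ 2) * ‖x‖ ^ 2 := by
        rw [h5]; positivity
      have h7 := pos_of_mul_pos_left h6 hN.le
      exact (pow_lt_pow_iff_left₀ h3.le h4.le two_ne_zero).1 (by linarith)
  refine hint.not_lt (Finset.sum_lt_sum (fun j _ => ?_) ⟨i, Finset.mem_univ i, ?_⟩)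
  · rcases (cell ξ j).eq_empty_or_nonempty with h | ⟨v, hv⟩
    · rw [h]; simp
    · have hj := ne_zero_of_mem_cell hK hv
      exact mul_le_mul_of_nonneg_left (Real.rpow_le_rpow
        (radialFn_pos (isBodyO_ellipsoid zero_le_one w) hj).le (hlt _ hj).1 (by linarith))
        measureReal_nonneg
  · have hne : ξ i ≠ 0 := fun h => hiw (by rw [h, inner_zero_left])
    exact mul_lt_mul_of_pos_left (Real.rpow_lt_rpow
      (radialFn_pos (isBodyO_ellipsoid zero_le_one w) hne).le ((hlt _ hne).2 hiw) (by linarith)) hi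

end Necessity

/-! ### Discrete measures and the two implications -/

section Main

variable {n : ℕ} {μ : Measure (S n)}

theorem integral_eq_sum_of_measure_compl_eq_zero [IsFiniteMeasure μ] {T : Finset (S n)}
    (hT : μ (T : Set (S n))ᶜ = 0) (f : S n → ℝ) :
    ∫ u, f u ∂μ = ∑ u : T, μ.real {(u : S n)} * f u := by
  have hint : IntegrableOn f (T : Set (S n)) μ := by
    rw [← biUnion_of_singleton (T : Set (S n)), integrableOn_finite_biUnion T.finite_toSet]
    intro u _
    exact integrableOn_singleton (by simp) (measure_lt_top μ _)
  have hrestr : μ.restrict (T : Set (S n)) = μ :=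
    Measure.restrict_eq_self_of_ae_mem (by rw [ae_iff]; exact hT)
  have h := setIntegral_finset T hint
  rw [hrestr] at h
  rw [h, ← Finset.sum_coe_sort]
  simp

theorem exists_finset_support [IsFiniteMeasure μ] (hμd : IsDiscreteMeasure μ) :
    ∃ T : Finset (S n), (∀ u, u ∈ T ↔ μ {u} ≠ 0) ∧ μ (T : Set (S n))ᶜ = 0 := by
  classical
  obtain ⟨F, hF, hF0⟩ := hμd
  have hmem : ∀ u, μ {u} ≠ 0 → u ∈ F := fun u hu => by
    by_contra h
    exact hu (measure_mono_null (singleton_subset_iff.2 h) hF0)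
  refine ⟨hF.toFinset.filter fun u => μ {u} ≠ 0, fun u => ?_, ?_⟩
  · simp only [Finset.mem_filter, Finite.mem_toFinset]
    exact ⟨fun h => h.2, fun h => ⟨hmem u h, h⟩⟩
  · have hsub : ((hF.toFinset.filter fun u => μ {u} ≠ 0 : Finset (S n)) : Set (S n))ᶜ ⊆
        Fᶜ ∪ ⋃ u ∈ {u | u ∈ F ∧ μ {u} = 0}, {u} := by
      intro u hu
      by_cases huF : u ∈ F
      · right
        simp only [mem_iUnion, mem_singleton_iff, exists_prop, exists_eq_right']
        refine ⟨huF, ?_⟩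
        by_contra h
        exact hu (by simp [huF, h])
      · exact Or.inl huF
    refine measure_mono_null hsub (measure_union_null hF0 ?_)
    refine (measure_biUnion_null_iff (hF.subset fun u hu => hu.1).countable).2 fun u hu => hu.2

theorem IsEvenMeasure.measure_singleton_neg (hμe : IsEvenMeasure μ) (u : S n) :
    μ {-u} = μ {u} := by
  rw [← hμe {u} (measurableSet_singleton u)]
  congr 1
  ext v
  simp only [mem_singleton_iff, mem_preimage]
  exact neg_eq_iff_eq_neg.symm

theorem exists_body_of_not_concentrated [IsFiniteMeasure μ] {p : ℝ} (hp₁ : -1 < p) (hp₀ : p < 0)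
    (hμ₀ : μ ≠ 0) (hμe : IsEvenMeasure μ) (hμd : IsDiscreteMeasure μ)
    (hμ : ∀ w : E n, w ≠ 0 → μ (greatSubsphere w)ᶜ ≠ 0) :
    ∃ K : Set (E n), IsBodyE K ∧ IsPolytope K ∧ IsLpIntegralCurvature p K μ := by
  classical
  obtain ⟨T, hT, hT0⟩ := exists_finset_support hμd
  have hTne : T.Nonempty := by
    by_contra h
    rw [Finset.not_nonempty_iff_eq_empty] at h
    rw [h, Finset.coe_empty, compl_empty] at hT0
    exact hμ₀ (Measure.measure_univ_eq_zero.1 hT0)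
  have : Nonempty T := hTne.to_subtype
  have : Nonempty (S n) := ⟨hTne.choose⟩
  have hq : 0 < -p := by linarith
  let e : T → S n := Subtype.val
  let τ : T → T := fun u => ⟨-u.1, by
    rw [hT, hμe.measure_singleton_neg]; exact (hT u.1).1 u.2⟩
  let m : T → ℝ := fun u => μ.real {u.1}
  have hτ : ∀ i, e (τ i) = -e i := fun _ => rfl
  have hm : ∀ i, 0 < m i := fun i => ENNReal.toReal_pos ((hT i.1).1 i.2) (measure_ne_top _ _)
  have hmτ : ∀ i, m (τ i) = m i := fun i => by
    simp only [m, τ, Measure.real, hμe.measure_singleton_neg]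
  have hspan : ∀ w : E n, w ≠ 0 → ∃ i, inner ℝ (e i : E n) w ≠ 0 := fun w hw => by
    by_contra! hcon
    refine hμ w hw (measure_mono_null (compl_subset_compl.2 fun u hu => ?_) hT0)
    exact hcon ⟨u, hu⟩
  obtain ⟨a, hapos, haτ, hcell⟩ := exists_weights hq (by linarith) Subtype.val_injective hτ hm hmτ
    (fun v => hspan v (norm_ne_zero_iff.1 (by rw [sphere_norm]; exact one_ne_zero)))
  have hcpos : ∀ i, 0 < a i ^ (1 / (-p)) := fun i => Real.rpow_pos_of_pos (hapos i) _
  set ξ : T → E n := fun i => a i ^ (1 / (-p)) • (e i : E n) with hξ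
  have hK : IsBodyE (convexHull ℝ (range ξ)) := by
    refine isBodyE_convexHull_range (τ := τ) (fun i => ?_) fun w hw => ?_
    · have : ((e (τ i) : S n) : E n) = -(e i : E n) := rfl
      simp only [hξ, haτ, this, smul_neg]
    · obtain ⟨i, hi⟩ := hspan w hw
      refine ⟨i, ?_⟩
      simp only [hξ, real_inner_smul_left]
      exact mul_ne_zero (hcpos i).ne' hi
  refine ⟨convexHull ℝ (range ξ), hK, ⟨Finset.univ.image ξ, by simp⟩, fun Q hQ => ?_⟩
  have h := hasDerivAt_entropy_harmonicCombination hp₀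
    (injective_smul_sphere Subtype.val_injective hcpos) hK.isBodyO hQ
  rw [integral_eq_sum_of_measure_compl_eq_zero hT0]
  -- Homogeneity gives `ρ_Q(ξ i) ^ (-p) = (a i)⁻¹ ρ_Q(e i) ^ (-p)`, which cancels the factor `a i`
  -- in the measure of the cell.
  have hsum : ∀ i : T, (sphereMeasure n).real (cell ξ i) * radialFn Q (ξ i) ^ (-p) =
      μ.real {(i : S n)} * radialFn Q (i : S n) ^ (-p) := fun i => by
    have hρ : 0 < radialFn Q (e i) :=
      radialFn_pos hQ (norm_ne_zero_iff.1 (by rw [sphere_norm]; exact one_ne_zero))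
    rw [hcell i, hξ, radialFn_smul Q (hcpos i), Real.mul_rpow (inv_pos.2 (hcpos i)).le hρ.le,
      Real.inv_rpow (hcpos i).le, ← Real.rpow_mul (hapos i).le, one_div_mul_cancel hq.ne',
      Real.rpow_one]
    have := (hapos i).ne'
    simp only [m, e]
    field_simp
  rw [← Finset.sum_congr rfl fun i _ => hsum i]
  exact h

theorem not_concentrated_of_isLpIntegralCurvature [Nonempty (S n)] {p : ℝ} (hp : p < 0)
    {K : Set (E n)} (hK : IsBodyE K) (hKp : IsPolytope K) (hμ : IsLpIntegralCurvature p K μ)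
    {w : E n} (hw : w ≠ 0) : μ (greatSubsphere w)ᶜ ≠ 0 := by
  obtain ⟨F, rfl⟩ := hKp
  have hFne : F.Nonempty := by
    have h := convexHull_nonempty_iff.1 ⟨0, hK.isBodyO.zero_mem⟩
    exact h
  have : Nonempty F := hFne.to_subtype
  have hrange : (F : Set (E n)) = range (Subtype.val : F → E n) := by simp
  have hKO := hK.isBodyO
  rw [hrange] at hKO hμ
  exact measure_compl_greatSubsphere_ne_zero hp Subtype.val_injective hKO hμ hw

end Main

end LpAleksandrov

end

theorem theorem1p3 (n : ℕ) (p : ℝ) (hp₁ : -1 < p) (hp₀ : p < 0)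
    (μ : MeasureTheory.Measure (LpAleksandrov.S n)) [MeasureTheory.IsFiniteMeasure μ]
    (hμ₀ : μ ≠ 0) (hμe : LpAleksandrov.IsEvenMeasure μ)
    (hμd : LpAleksandrov.IsDiscreteMeasure μ) :
    (∃ K : Set (LpAleksandrov.E n), LpAleksandrov.IsBodyE K ∧ LpAleksandrov.IsPolytope K ∧
        LpAleksandrov.IsLpIntegralCurvature p K μ) ↔
      ∀ w : LpAleksandrov.E n, w ≠ 0 → μ (LpAleksandrov.greatSubsphere w)ᶜ ≠ 0 := by
  constructor
  · rintro ⟨K, hK, hKp, hKμ⟩ w hw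
    -- A nonzero measure rules out the empty sphere of dimension `n = 0`.
    have : Nonempty (LpAleksandrov.S n) := by
      by_contra h
      rw [not_nonempty_iff] at h
      exact hμ₀ (MeasureTheory.Measure.eq_zero_of_isEmpty μ)
    exact LpAleksandrov.not_concentrated_of_isLpIntegralCurvature hp₀ hK hKp hKμ hw
  · exact LpAleksandrov.exists_body_of_not_concentrated hp₁ hp₀ hμ₀ hμe hμd
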